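/- Let $\Omega\subset\mathbb{R}^2$ be a compact set, and let $\mathcal{B}(\Omega)$ be the set of Borel probability measures on $\Omega$ with the topology of weak convergence (tested against bounded continuous functions on $\Omega$). For $\mu\in\mathcal{B}(\Omega)$ put $E(\mu)=\int_\Omega\rho\ln\rho\,dx\in\mathbb{R}\cup\{+\infty\}$ if $\mu=\rho\,dx$ has a density with respect to Lebesgue measure, and $E(\mu)=+\infty$ otherwise. For a set $X=\{x_1,\dots,x_N\}$ of $N$ distinct points of $\Omega$ put $\delta_X=\frac1N\sum_{i=1}^N\delta_{x_i}$ and, for $N\ge 2$, $r_i(X)=\frac12\min_{j\ne i}|x_i-x_j|$ and $$\mathcal{E}(X)=-\frac{2}{N}\sum_{i=1}^{N}\ln r_i(X)-\ln\bigl(2\sqrt3\,N\bigr)$$ (for $N=1$ the value $\mathcal{E}(X)\in\mathbb{R}$ is an arbitrary convention and plays no role). Then $\mathcal{E}$ is a $\Gamma$-approximation of the entropy $E$, that is: (i) for every sequence $(X_N)_{N\ge1}$, where $X_N$ consists of $N$ distinct points of $\Omega$, and every $\mu\in\mathcal{B}(\Omega)$ such that $\delta_{X_N}\to\mu$ weakly,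 $\liminf_{N\to\infty}\mathcal{E}(X_N)\ge E(\mu)$; (ii) for every $\mu\in\mathcal{B}(\Omega)$ with $E(\mu)<\infty$ there is a sequence $(\tilde X_N)_{N\ge1}$, where $\tilde X_N$ consists of $N$ distinct points of $\Omega$, such that $\delta_{\tilde X_N}\to\mu$ weakly and $\lim_{N\to\infty}\mathcal{E}(\tilde X_N)=E(\mu)$. -/

import Mathlib

open MeasureTheory Filter Topology
open scoped ENNReal

noncomputable section

namespace EntropyApprox

/-- The Euclidean plane. -/
abbrev Plane : Type := EuclideanSpace ℝ (Fin 2)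

/-- The Lebesgue measure of the plane, restricted to `Ω`, as a measure on the subtype `Ω`. -/
def area (Ω : Set Plane) : Measure Ω := (volume : Measure Plane).comap Subtype.val

/-- The entropy `E(μ) = ∫_Ω ρ ln ρ` of a Borel probability measure `μ` on `Ω`, where `ρ` is the
density of `μ` with respect to the Lebesgue measure on `Ω`, and `E(μ) = +∞` if `μ` has no
density.
The Lebesgue integral is the integral of the positive part minus that of the negative part. The
latter is finite when `Ω` has finite area, as `t ln t ≥ -1/e`; the former may be `+∞`. -/
def entropy {Ω : Set Plane} (μ : ProbabilityMeasure Ω) : EReal :=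
  open Classical in
  let ρ : Ω → ℝ := fun x => ((μ : Measure Ω).rnDeriv (area Ω) x).toReal
  if (μ : Measure Ω) ≪ area Ω then
    ((∫⁻ x, ENNReal.ofReal (ρ x * Real.log (ρ x)) ∂(area Ω) : ℝ≥0∞) : EReal)
      - ((∫⁻ x, ENNReal.ofReal (-(ρ x * Real.log (ρ x))) ∂(area Ω) : ℝ≥0∞) : EReal)
  else ⊤

/-- The finite nonempty unordered families `X = (x₁, …, x_N)`, `N ≥ 1`, of distinct points
of `Ω`. -/
abbrev Configuration (Ω : Set Plane) : Type := {X : Finset Ω // X.Nonempty}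

/-- The number `N(X)` of points of a configuration. -/
def numPoints {Ω : Set Plane} (X : Configuration Ω) : ℕ := X.1.card

/-- The empirical measure `δ_X = N(X)⁻¹ ∑ᵢ δ_{xᵢ}`. -/
def empirical {Ω : Set Plane} (X : Configuration Ω) : ProbabilityMeasure Ω :=
  ⟨(numPoints X : ℝ≥0∞)⁻¹ • ∑ x ∈ X.1, Measure.dirac x, ⟨by
    have h : (X.1.card : ℝ≥0∞) ≠ 0 := by
      exact_mod_cast (Finset.card_pos.mpr X.2).ne'
    simp [numPoints, ENNReal.inv_mul_cancel h (ENNReal.natCast_ne_top _)]⟩⟩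

/-- `r_x(X)`: half the minimal distance from `x` to the other points of `X`.
(If `X` has no other point, the value is `0` by convention.) -/
def halfMinDist {Ω : Set Plane} (X : Configuration Ω) (x : Ω) : ℝ :=
  (1 / 2) * Metric.infDist x ((X.1 : Set Ω) \ {x})

/-- `𝓔(X) = -(2 / N(X)) ∑ᵢ ln rᵢ(X) - ln (2 √3 N(X))`. -/
def discreteEntropy {Ω : Set Plane} (X : Configuration Ω) : ℝ :=
  -(2 / (numPoints X : ℝ)) * ∑ x ∈ X.1, Real.log (halfMinDist X x)
    - Real.log (2 * Real.sqrt 3 * (numPoints X : ℝ))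

/-- `F`, a function on configurations with values in `ℝ ∪ {+∞}`, is a `Γ`-approximation of the
entropy. Convergence of measures is convergence in the topology of `ProbabilityMeasure Ω`, that
is, weak convergence tested against bounded continuous functions. -/
structure IsGammaApproximation {Ω : Set Plane} (F : Configuration Ω → EReal) : Prop where
  ne_bot : ∀ X, F X ≠ ⊥
  liminf_ge : ∀ (X : ℕ+ → Configuration Ω) (μ : ProbabilityMeasure Ω),
    (∀ N : ℕ+, numPoints (X N) = N) →
    Tendsto (fun N => empirical (X N)) atTop (𝓝 μ) →
    entropy μ ≤ liminf (fun N => F (X N)) atTop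
  exists_recovery : ∀ μ : ProbabilityMeasure Ω, entropy μ < ⊤ →
    ∃ X : ℕ+ → Configuration Ω,
      (∀ N : ℕ+, numPoints (X N) = N) ∧
      Tendsto (fun N => empirical (X N)) atTop (𝓝 μ) ∧
      Tendsto (fun N => F (X N)) atTop (𝓝 (entropy μ))

end EntropyApprox

end

/-
Lower bound: by duality `E(μ) = sup_φ ∫ φ dμ + 1 - ∫ exp φ dx` over continuous `φ`, and for fixed
`φ` the inequality `log t ≤ t - 1` reduces `∫ φ dδ_X + 1 - ∫ exp φ dx ≤ 𝓔(X) + o(1)` to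
`∑ 2√3 rᵢ² exp (φ xᵢ) ≤ ∫ exp φ dx + o(1)`. This holds because in the power diagram of the discs of
radii `Rᵢ = 2 rᵢ / √3` every cell has area at least `2√3 rᵢ²`, the area of the regular hexagon
inscribed in the disc. Indeed a disc loses to each neighbour a cap of half-angle at most `π / 6`,
whose share of its sector is at most the one in the hexagon, and the sectors of these caps are
disjoint because no three of the discs have a point in common.

Recovery: partition `Ω` into finitely many small pieces and fill a compact part of each with points
of a triangular lattice of the density that `μ` prescribes, for which the lower bound is
asymptotically an equality. By the data processing inequality the entropy of the partition is at
most `E(μ)`, and a diagonal argument combines the partitions.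
-/

namespace EntropyApprox

section CircularSector

open Real Set

/-- The open circular sector of radius `R` and half-angle `α` about the positive first axis. -/
def axisSector (R α : ℝ) : Set (ℝ × ℝ) :=
  {q | √(q.1 ^ 2 + q.2 ^ 2) < R} ∩ {q | cos α * √(q.1 ^ 2 + q.2 ^ 2) < q.1}

/-- The part of `axisSector R α` beyond the chord joining the ends of its arc. -/
def axisCap (R α : ℝ) : Set (ℝ × ℝ) :=
  {q | √(q.1 ^ 2 + q.2 ^ 2) < R} ∩ {q | R * cos α ≤ q.1}

/-- The open triangle spanned by the centre and the chord of `axisSector R α`. -/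
def axisTriangle (R α : ℝ) : Set (ℝ × ℝ) :=
  regionBetween (fun x => -(tan α * x)) (fun x => tan α * x) (Ioo 0 (R * cos α))

lemma measurableSet_axisSector (R α : ℝ) : MeasurableSet (axisSector R α) :=
  (measurableSet_lt (by fun_prop) (by fun_prop)).inter
    (measurableSet_lt (by fun_prop) (by fun_prop))

lemma measurableSet_axisCap (R α : ℝ) : MeasurableSet (axisCap R α) :=
  (measurableSet_lt (by fun_prop) (by fun_prop)).inter
    (measurableSet_le (by fun_prop) (by fun_prop))

lemma measurableSet_axisTriangle (R α : ℝ) : MeasurableSet (axisTriangle R α) :=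
  measurableSet_regionBetween (by fun_prop) (by fun_prop) measurableSet_Ioo

lemma mem_prod_Ioo_of_polarCoord_symm_mem_axisSector {R α : ℝ} (hα₀ : 0 ≤ α) (hα : α ≤ π)
    {p : ℝ × ℝ} (hp : p ∈ polarCoord.target) (h : polarCoord.symm p ∈ axisSector R α) :
    p ∈ Ioo 0 R ×ˢ Ioo (-α) α := by
  obtain ⟨r, θ⟩ := p
  simp only [polarCoord_target, mem_prod, mem_Ioi, mem_Ioo] at hp
  obtain ⟨hr, hθ₁, hθ₂⟩ := hp
  have hnorm : √((r * cos θ) ^ 2 + (r * sin θ) ^ 2) = r := by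
    rw [mul_pow, mul_pow, ← mul_add, cos_sq_add_sin_sq, mul_one, sqrt_sq hr.le]
  simp only [axisSector, polarCoord_symm_apply, mem_inter_iff, mem_ofPred_eq, hnorm,
    mul_comm (cos α)] at h
  have hcos : cos α < cos |θ| := by
    rw [cos_abs]
    exact lt_of_mul_lt_mul_left h.2 hr.le
  have hθ : |θ| < α :=
    (strictAntiOn_cos.lt_iff_gt ⟨hα₀, hα⟩ ⟨abs_nonneg θ, abs_le.2 ⟨hθ₁.le, hθ₂.le⟩⟩).1 hcos
  exact ⟨⟨hr, h.1⟩, abs_lt.1 hθ⟩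

lemma setLIntegral_prod_Ioo_ofReal_fst {R α : ℝ} (hR : 0 ≤ R) :
    ∫⁻ p in Ioo 0 R ×ˢ Ioo (-α) α, ENNReal.ofReal p.1 = ENNReal.ofReal (R ^ 2 * α) := by
  have hradial : ∫⁻ r in Ioo 0 R, ENNReal.ofReal r = ENNReal.ofReal (R ^ 2 / 2) := by
    rw [← ofReal_integral_eq_lintegral_ofReal, ← integral_Ioc_eq_integral_Ioo,
      ← intervalIntegral.integral_of_le hR, integral_id]
    · simp
    · exact continuous_id.integrableOn_Icc.mono_set Ioo_subset_Icc_self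
    · exact (ae_restrict_mem measurableSet_Ioo).mono fun r hr => hr.1.le
  rw [Measure.volume_eq_prod, setLIntegral_prod _ (by fun_prop)]
  simp only [setLIntegral_const, Real.volume_Ioo]
  rw [lintegral_mul_const _ (by fun_prop), hradial, ← ENNReal.ofReal_mul (by positivity)]
  congr 1
  ring

lemma volume_axisSector_le {R α : ℝ} (hR : 0 ≤ R) (hα₀ : 0 ≤ α) (hα : α ≤ π) :
    volume (axisSector R α) ≤ ENNReal.ofReal (R ^ 2 * α) := by
  rw [← lintegral_indicator_one (measurableSet_axisSector R α), ← lintegral_comp_polarCoord_symm]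
  calc ∫⁻ p in polarCoord.target,
        ENNReal.ofReal p.1 • (axisSector R α).indicator 1 (polarCoord.symm p)
      ≤ ∫⁻ p in polarCoord.target,
          (Ioo 0 R ×ˢ Ioo (-α) α).indicator (fun p => ENNReal.ofReal p.1) p := by
        refine setLIntegral_mono' polarCoord.open_target.measurableSet fun p hp => ?_
        by_cases h : polarCoord.symm p ∈ axisSector R α
        · rw [indicator_of_mem h,
            indicator_of_mem (mem_prod_Ioo_of_polarCoord_symm_mem_axisSector hα₀ hα hp h)]
          simp
        · rw [indicator_of_notMem h, smul_zero]
          exact zero_le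
    _ ≤ ∫⁻ p, (Ioo 0 R ×ˢ Ioo (-α) α).indicator (fun p => ENNReal.ofReal p.1) p :=
        setLIntegral_le_lintegral _ _
    _ = ENNReal.ofReal (R ^ 2 * α) := by
        rw [lintegral_indicator (measurableSet_Ioo.prod measurableSet_Ioo),
          setLIntegral_prod_Ioo_ofReal_fst hR]

lemma volume_axisTriangle {R α : ℝ} (hR : 0 ≤ R) (hα₀ : 0 ≤ α) (hα : α < π / 2) :
    volume (axisTriangle R α) = ENNReal.ofReal (R ^ 2 * (sin α * cos α)) := by
  have hcos : 0 < cos α := cos_pos_of_mem_Ioo ⟨by linarith [pi_pos], hα⟩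
  have htan : 0 ≤ tan α := tan_nonneg_of_nonneg_of_le_pi_div_two hα₀ hα.le
  have hint (c : ℝ) : IntegrableOn (fun x : ℝ => c * x) (Ioo 0 (R * cos α)) :=
    (Continuous.integrableOn_Icc (by fun_prop)).mono_set Ioo_subset_Icc_self
  rw [axisTriangle, Measure.volume_eq_prod,
    volume_regionBetween_eq_integral (by simpa only [neg_mul] using hint (-tan α))
      (hint (tan α)) measurableSet_Ioo fun x hx => by nlinarith [hx.1, mul_nonneg htan hx.1.le]]
  congr 1
  calc ∫ x in Ioo 0 (R * cos α), ((fun x => tan α * x) - fun x => -(tan α * x)) x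
      = ∫ x in 0..R * cos α, 2 * tan α * x := by
        rw [← integral_Ioc_eq_integral_Ioo, ← intervalIntegral.integral_of_le (by positivity)]
        congr 1 with x
        simp only [Pi.sub_apply]
        ring
    _ = R ^ 2 * (cos α * tan α * cos α) := by
        rw [intervalIntegral.integral_const_mul, integral_id]
        ring
    _ = R ^ 2 * (sin α * cos α) := by
        rw [mul_comm (cos α), tan_mul_cos hcos.ne']

lemma axisTriangle_subset_axisSector {R α : ℝ} (hα₀ : 0 ≤ α) (hα : α < π / 2) :
    axisTriangle R α ⊆ axisSector R α := by
  rintro ⟨x, y⟩ ⟨⟨hx₀, hx⟩, hy⟩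
  dsimp only at hx₀ hx hy
  have hcos : 0 < cos α := cos_pos_of_mem_Ioo ⟨by linarith [pi_pos], hα⟩
  have hxy : cos α * |y| < sin α * x := by
    calc cos α * |y| < cos α * (tan α * x) := by gcongr; exact abs_lt.2 hy
      _ = sin α * x := by rw [← tan_mul_cos hcos.ne']; ring
  have hxy_sq : cos α ^ 2 * y ^ 2 < sin α ^ 2 * x ^ 2 := by
    rw [← sq_abs y, ← mul_pow, ← mul_pow]
    exact pow_lt_pow_left₀ hxy (by positivity) two_ne_zero
  have hangle : cos α * √(x ^ 2 + y ^ 2) < x := by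
    rw [← sqrt_sq hcos.le, ← sqrt_mul (by positivity), sqrt_lt' hx₀]
    nlinarith [sin_sq_add_cos_sq α]
  refine ⟨?_, hangle⟩
  rw [mul_comm R] at hx
  exact lt_of_mul_lt_mul_left (hangle.trans hx) hcos.le

lemma axisCap_subset_axisSector_diff_axisTriangle {R α : ℝ} (hcos : 0 < cos α) :
    axisCap R α ⊆ axisSector R α \ axisTriangle R α := by
  rintro q ⟨hR, hq⟩
  refine ⟨⟨hR, ?_⟩, fun h => hq.not_gt h.1.2⟩
  calc cos α * √(q.1 ^ 2 + q.2 ^ 2) < cos α * R := by gcongr; exact hR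
    _ = R * cos α := mul_comm _ _
    _ ≤ q.1 := hq

lemma mul_le_sin_mul_cos {α : ℝ} (hα₀ : 0 ≤ α) (hα : α ≤ π / 6) :
    3 * √3 / (2 * π) * α ≤ sin α * cos α := by
  have hchord := strictConcaveOn_sin_Icc.concaveOn.2
    (show (0 : ℝ) ∈ Icc 0 π from ⟨le_rfl, pi_pos.le⟩)
    (show π / 3 ∈ Icc 0 π from ⟨by positivity, by linarith [pi_pos]⟩)
    (show 0 ≤ 1 - 6 * α / π by rw [sub_nonneg, div_le_one pi_pos]; linarith)
    (show 0 ≤ 6 * α / π by positivity) (by ring)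
  simp only [smul_eq_mul, sin_zero, sin_pi_div_three, mul_zero, zero_add] at hchord
  calc 3 * √3 / (2 * π) * α = 6 * α / π * (√3 / 2) / 2 := by field_simp; ring
    _ ≤ sin (6 * α / π * (π / 3)) / 2 := by gcongr
    _ = sin (2 * α) / 2 := by congr 2; field_simp; ring
    _ = sin α * cos α := by rw [sin_two_mul]; ring

/-- The fraction of a circular sector of angle `π / 3` that lies beyond its chord. -/
noncomputable def capRatio : ℝ := 1 - 3 * √3 / (2 * π)

lemma capRatio_nonneg : 0 ≤ capRatio := by
  have hsqrt : √3 ≤ 2 := sqrt_le_iff.2 (by norm_num)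
  rw [capRatio, sub_nonneg, div_le_one (by positivity)]
  linarith [pi_gt_three]

lemma volume_axisCap_le {R α : ℝ} (hR : 0 ≤ R) (hα₀ : 0 ≤ α) (hα : α ≤ π / 6) :
    volume (axisCap R α) ≤ ENNReal.ofReal capRatio * volume (axisSector R α) := by
  have hα₂ : α < π / 2 := by linarith [pi_pos]
  have hcos : 0 < cos α := cos_pos_of_mem_Ioo ⟨by linarith [pi_pos], hα₂⟩
  have hsin : 0 ≤ sin α := sin_nonneg_of_nonneg_of_le_pi hα₀ (by linarith [pi_pos])
  have hle := volume_axisSector_le hR hα₀ (by linarith [pi_pos])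
  have hfin : volume (axisSector R α) ≠ ∞ := ne_top_of_le_ne_top ENNReal.ofReal_ne_top hle
  have htriangle : 3 * √3 / (2 * π) * volume.real (axisSector R α) ≤
      volume.real (axisTriangle R α) := by
    calc 3 * √3 / (2 * π) * volume.real (axisSector R α)
        ≤ 3 * √3 / (2 * π) * (R ^ 2 * α) := by
          gcongr
          exact ENNReal.toReal_le_of_le_ofReal (by positivity) hle
      _ = R ^ 2 * (3 * √3 / (2 * π) * α) := by ring
      _ ≤ R ^ 2 * (sin α * cos α) := by
          exact mul_le_mul_of_nonneg_left (mul_le_sin_mul_cos hα₀ hα) (sq_nonneg R)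
      _ = volume.real (axisTriangle R α) := by
          rw [Measure.real, volume_axisTriangle hR hα₀ hα₂, ENNReal.toReal_ofReal (by positivity)]
  calc volume (axisCap R α) ≤ volume (axisSector R α \ axisTriangle R α) :=
        measure_mono (axisCap_subset_axisSector_diff_axisTriangle hcos)
    _ = ENNReal.ofReal (volume.real (axisSector R α) - volume.real (axisTriangle R α)) := by
        rw [← measureReal_sdiff (axisTriangle_subset_axisSector hα₀ hα₂)
            (measurableSet_axisTriangle R α) hfin,
          ofReal_measureReal (measure_ne_top_of_subset sdiff_subset hfin)]
    _ ≤ ENNReal.ofReal (capRatio * volume.real (axisSector R α)) := by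
        rw [capRatio]
        apply ENNReal.ofReal_le_ofReal
        linarith
    _ = ENNReal.ofReal capRatio * volume (axisSector R α) := by
        rw [ENNReal.ofReal_mul capRatio_nonneg, ofReal_measureReal hfin]

end CircularSector

section Discs

open Metric

variable {V : Type*} [NormedAddCommGroup V] [InnerProductSpace ℝ V]

/-- The sector of the disc of radius `R` about `x` formed by the directions that enclose an angle
of cosine greater than `c` with the unit vector `u`. -/
def discSector (x u : V) (R c : ℝ) : Set V :=
  ball x R ∩ {p | c * ‖p - x‖ < inner ℝ u (p - x)}

/-- The cap of the disc of radius `R` about `x` cut off by the line orthogonal to the unit vector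
`u` at distance `h` from `x`. -/
def discCap (x u : V) (R h : ℝ) : Set V :=
  ball x R ∩ {p | h ≤ inner ℝ u (p - x)}

lemma discCap_eq_empty {x u : V} {R h : ℝ} (hu : ‖u‖ = 1) (hRh : R ≤ h) :
    discCap x u R h = ∅ := by
  refine Set.eq_empty_of_forall_notMem fun p ⟨hp, hpu⟩ => ?_
  have hle : inner ℝ u (p - x) ≤ ‖p - x‖ := by simpa [hu] using real_inner_le_norm u (p - x)
  rw [mem_ball_iff_norm] at hp
  exact ((hRh.trans hpu).trans hle).not_gt hp

lemma exists_measurePreserving_coordinates {u : Plane} (hu : ‖u‖ = 1) :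
    ∃ f : Plane → ℝ × ℝ, MeasurePreserving f volume volume ∧
      (∀ p, (f p).1 = inner ℝ u p) ∧ ∀ p, √((f p).1 ^ 2 + (f p).2 ^ 2) = ‖p‖ := by
  have ho : Orthonormal ℝ (({0} : Set (Fin 2)).domRestrict fun _ => u) :=
    ⟨fun _ => hu, fun i j hij => absurd (Subsingleton.elim i j) hij⟩
  obtain ⟨b, hb⟩ := ho.exists_orthonormalBasis_extension_of_card_eq (by simp)
  refine ⟨fun p => (b.repr p 0, b.repr p 1), ?_, fun p => ?_, fun p => ?_⟩
  · exact (volume_preserving_finTwoArrow ℝ).comp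
      ((EuclideanSpace.volume_preserving_symm_measurableEquiv_toLp (Fin 2)).comp
        b.measurePreserving_repr)
  · dsimp only
    rw [b.repr_apply_apply, hb 0 rfl]
  · rw [← b.repr.norm_map p, EuclideanSpace.norm_eq]
    simp [Fin.sum_univ_two]

open Real in
lemma volume_discCap_le {x u : Plane} {R h : ℝ} (hu : ‖u‖ = 1) (hR : 0 < R)
    (hh : √3 / 2 * R ≤ h) :
    volume (discCap x u R h) ≤ ENNReal.ofReal capRatio * volume (discSector x u R (h / R)) := by
  rcases le_or_gt R h with hRh | hRh
  · simp [discCap_eq_empty hu hRh]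
  have hratio : √3 / 2 ≤ h / R := (le_div_iff₀ hR).2 hh
  have hcos : cos (arccos (h / R)) = h / R :=
    cos_arccos (by linarith [sqrt_nonneg 3]) ((div_le_one hR).2 hRh.le)
  have hα : arccos (h / R) ≤ π / 6 := by
    rw [← arccos_cos (by positivity) (by linarith [pi_pos] : π / 6 ≤ π), cos_pi_div_six]
    exact arccos_le_arccos hratio
  obtain ⟨f, hf, hf_fst, hf_norm⟩ := exists_measurePreserving_coordinates hu
  have hg : MeasurePreserving (fun p => f (p - x)) volume volume :=
    hf.comp (measurePreserving_sub_right volume x)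
  have hsector : (fun p => f (p - x)) ⁻¹' axisSector R (arccos (h / R)) =
      discSector x u R (h / R) := by
    ext p
    simp only [axisSector, discSector, Set.mem_preimage, Set.mem_inter_iff, Set.mem_ofPred_eq,
      hf_norm, hcos, mem_ball_iff_norm]
    rw [hf_fst]
  have hcap : (fun p => f (p - x)) ⁻¹' axisCap R (arccos (h / R)) = discCap x u R h := by
    ext p
    simp only [axisCap, discCap, Set.mem_preimage, Set.mem_inter_iff, Set.mem_ofPred_eq,
      hf_norm, hcos, mem_ball_iff_norm, mul_div_cancel₀ h hR.ne']
    rw [hf_fst]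
  rw [← hsector, ← hcap, hg.measure_preimage (measurableSet_axisSector _ _).nullMeasurableSet,
    hg.measure_preimage (measurableSet_axisCap _ _).nullMeasurableSet]
  exact volume_axisCap_le hR.le (arccos_nonneg _) hα

lemma exists_inner_ge_neg_half (a b c : V) :
    -(1 / 2 * (‖a‖ * ‖b‖)) ≤ inner ℝ a b ∨ -(1 / 2 * (‖a‖ * ‖c‖)) ≤ inner ℝ a c ∨
      -(1 / 2 * (‖b‖ * ‖c‖)) ≤ inner ℝ b c := by
  by_contra! ⟨hab, hac, hbc⟩
  have ha : 0 < ‖a‖ := norm_pos_iff.2 (by rintro rfl; simp at hab)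
  have hb : 0 < ‖b‖ := norm_pos_iff.2 (by rintro rfl; simp at hab)
  have hc : 0 < ‖c‖ := norm_pos_iff.2 (by rintro rfl; simp at hac)
  -- Otherwise the sum of the three unit vectors, here scaled by `‖a‖ ‖b‖ ‖c‖`, has negative norm.
  have hsum := real_inner_self_nonneg
    (x := (‖b‖ * ‖c‖) • a + (‖a‖ * ‖c‖) • b + (‖a‖ * ‖b‖) • c)
  simp only [inner_add_left, inner_add_right, real_inner_smul_left, real_inner_smul_right,
    real_inner_self_eq_norm_sq, norm_smul, norm_mul, norm_norm,
    real_inner_comm a b, real_inner_comm a c, real_inner_comm b c] at hsum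
  have hab' := mul_lt_mul_of_pos_left hab (show 0 < ‖a‖ * ‖b‖ * ‖c‖ ^ 2 by positivity)
  have hac' := mul_lt_mul_of_pos_left hac (show 0 < ‖a‖ * ‖c‖ * ‖b‖ ^ 2 by positivity)
  have hbc' := mul_lt_mul_of_pos_left hbc (show 0 < ‖b‖ * ‖c‖ * ‖a‖ ^ 2 by positivity)
  nlinarith

lemma norm_sub_lt_of_inner_ge {a b : V} {R S : ℝ} (h : -(1 / 2 * (‖a‖ * ‖b‖)) ≤ inner ℝ a b)
    (ha : ‖a‖ ≤ R) (hb : ‖b‖ < S) : ‖a - b‖ < √3 * max R S := by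
  have ha' : ‖a‖ ≤ max R S := ha.trans (le_max_left _ _)
  have hb' : ‖b‖ < max R S := hb.trans_le (le_max_right _ _)
  have hmax : 0 ≤ max R S := (norm_nonneg a).trans ha'
  refine lt_of_pow_lt_pow_left₀ 2 (by positivity) ?_
  rw [norm_sub_sq_real, mul_pow, Real.sq_sqrt zero_le_three]
  have hmul := mul_le_mul ha' hb'.le (norm_nonneg _) hmax
  nlinarith [pow_le_pow_left₀ (norm_nonneg a) ha' 2,
    pow_lt_pow_left₀ hb' (norm_nonneg b) two_ne_zero]

lemma not_mem_three_discs {p x y z : V} {R S T : ℝ} (hxy : √3 * max R S ≤ ‖x - y‖)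
    (hxz : √3 * max R T ≤ ‖x - z‖) (hyz : √3 * max S T ≤ ‖y - z‖)
    (hx : ‖p - x‖ ≤ R) (hy : ‖p - y‖ < S) : ¬ ‖p - z‖ < T := by
  intro hz
  have hsub (u v : V) : ‖(p - u) - (p - v)‖ = ‖u - v‖ := by
    rw [sub_sub_sub_cancel_left, norm_sub_rev]
  rcases exists_inner_ge_neg_half (p - x) (p - y) (p - z) with h | h | h
  · exact hxy.not_gt (hsub x y ▸ norm_sub_lt_of_inner_ge h hx hy)
  · exact hxz.not_gt (hsub x z ▸ norm_sub_lt_of_inner_ge h hx hz)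
  · exact hyz.not_gt (hsub y z ▸ norm_sub_lt_of_inner_ge h hy.le hz)

end Discs

section PowerDiagram

open Metric

variable {V : Type*} [NormedAddCommGroup V] [InnerProductSpace ℝ V]

/-- The power of the point `p` with respect to the circle of radius `R` about `x`. -/
def power (x : V) (R : ℝ) (p : V) : ℝ := ‖p - x‖ ^ 2 - R ^ 2

/-- The distance from the centre of a circle of radius `R` to its radical axis with a circle of
radius `S` whose centre lies at distance `d`. -/
noncomputable def axisDist (R S d : ℝ) : ℝ := (d ^ 2 + R ^ 2 - S ^ 2) / (2 * d)

/-- The unit vector pointing from `x` to `y`. -/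
noncomputable def direction (x y : V) : V := ‖y - x‖⁻¹ • (y - x)

lemma norm_direction {x y : V} (hxy : x ≠ y) : ‖direction x y‖ = 1 :=
  norm_smul_inv_norm (𝕜 := ℝ) (sub_ne_zero.2 hxy.symm)

lemma le_axisDist {R S d : ℝ} (hR : 0 < R) (hS : 0 ≤ S) (h : √3 * max R S ≤ d) :
    √3 / 2 * R ≤ axisDist R S d := by
  have hRd : √3 * R ≤ d := le_trans (by gcongr; exact le_max_left _ _) h
  have hSd : √3 * S ≤ d := le_trans (by gcongr; exact le_max_right _ _) h
  have hsqrt : √3 ^ 2 = 3 := Real.sq_sqrt zero_le_three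
  have hd : 0 < d := lt_of_lt_of_le (by positivity) hRd
  rw [axisDist, le_div_iff₀ (by linarith)]
  rcases le_total R S with _ | _
  · nlinarith [Real.sqrt_nonneg 3, mul_nonneg (Real.sqrt_nonneg 3) hS]
  · nlinarith

lemma inner_direction (x y p : V) :
    inner ℝ (direction x y) (p - x) = inner ℝ (y - x) (p - x) / ‖y - x‖ := by
  rw [direction, real_inner_smul_left, inv_mul_eq_div]

lemma power_sub_power (x y p : V) (R S : ℝ) :
    power x R p - power y S p =
      2 * inner ℝ (y - x) (p - x) - (‖y - x‖ ^ 2 + R ^ 2 - S ^ 2) := by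
  rw [power, power, ← sub_sub_sub_cancel_right p y x, norm_sub_sq_real (p - x) (y - x),
    real_inner_comm]
  ring

lemma power_le_power_iff {x y p : V} {R S : ℝ} (hxy : x ≠ y) :
    power y S p ≤ power x R p ↔
      axisDist R S ‖y - x‖ ≤ inner ℝ (direction x y) (p - x) := by
  have hd : 0 < ‖y - x‖ := norm_pos_iff.2 (sub_ne_zero.2 hxy.symm)
  rw [← sub_nonneg, power_sub_power, sub_nonneg, inner_direction, axisDist, mul_comm 2 ‖y - x‖,
    ← div_div, div_right_comm, div_le_div_iff_of_pos_right hd, div_le_iff₀' two_pos]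

lemma power_lt_power_iff {x y p : V} {R S : ℝ} (hxy : x ≠ y) :
    power y S p < power x R p ↔
      axisDist R S ‖y - x‖ < inner ℝ (direction x y) (p - x) := by
  have hd : 0 < ‖y - x‖ := norm_pos_iff.2 (sub_ne_zero.2 hxy.symm)
  rw [← sub_pos, power_sub_power, sub_pos, inner_direction, axisDist, mul_comm 2 ‖y - x‖,
    ← div_div, div_right_comm, div_lt_div_iff_of_pos_right hd, div_lt_iff₀' two_pos]

/-- The cap that the radical axis of the circles of radii `R`, `S` about `x`, `y` cuts off the disc
about `x`. -/
noncomputable def radicalCap (x y : V) (R S : ℝ) : Set V :=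
  discCap x (direction x y) R (axisDist R S ‖y - x‖)

/-- The sector of the disc about `x` spanned by the chord of `radicalCap x y R S`. -/
noncomputable def radicalSector (x y : V) (R S : ℝ) : Set V :=
  discSector x (direction x y) R (axisDist R S ‖y - x‖ / R)

/-- The end point of the radius of the disc about `x` through `p`. -/
noncomputable def radialProjection (x : V) (R : ℝ) (p : V) : V := x + (R / ‖p - x‖) • (p - x)

lemma norm_radialProjection_sub {x p : V} {R : ℝ} (hR : 0 ≤ R) (hp : p ≠ x) :
    ‖radialProjection x R p - x‖ = R := by
  have hpx : ‖p - x‖ ≠ 0 := norm_ne_zero_iff.2 (sub_ne_zero.2 hp)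
  rw [radialProjection, add_sub_cancel_left, norm_smul, norm_div, norm_norm,
    Real.norm_of_nonneg hR, div_mul_cancel₀ _ hpx]

lemma ne_of_mem_radicalSector {x y p : V} {R S : ℝ} (hp : p ∈ radicalSector x y R S) :
    p ≠ x := by
  rintro rfl
  simpa using hp.2

lemma norm_radialProjection_sub_lt {x y p : V} {R S : ℝ} (hxy : x ≠ y) (hR : 0 < R) (hS : 0 ≤ S)
    (hp : p ∈ radicalSector x y R S) : ‖radialProjection x R p - y‖ < S := by
  have hne := ne_of_mem_radicalSector hp
  have hpos : 0 < ‖p - x‖ := norm_pos_iff.2 (sub_ne_zero.2 hne)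
  have haxis : axisDist R S ‖y - x‖ <
      inner ℝ (direction x y) (radialProjection x R p - x) := by
    have h : axisDist R S ‖y - x‖ / R * ‖p - x‖ < inner ℝ (direction x y) (p - x) := hp.2
    rw [radialProjection, add_sub_cancel_left, real_inner_smul_right, div_mul_eq_mul_div,
      lt_div_iff₀ hpos]
    rwa [div_mul_eq_mul_div, div_lt_iff₀' hR] at h
  have hpower := (power_lt_power_iff hxy).2 haxis
  rw [power, power, norm_radialProjection_sub hR.le hne, sub_self, sub_neg] at hpower
  exact lt_of_pow_lt_pow_left₀ 2 hS hpower

lemma ne_of_mul_max_le {E : Type*} [NormedAddCommGroup E] {x y : E} {R S : ℝ} (hR : 0 < R)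
    (h : √3 * max R S ≤ ‖x - y‖) : x ≠ y := by
  rintro rfl
  rw [sub_self, norm_zero] at h
  have : 0 < √3 * max R S := by positivity
  linarith

/-- A common point of the two sectors would project radially to a point of all three discs. -/
lemma disjoint_radicalSector {x y z : V} {R S T : ℝ} (hR : 0 < R) (hS : 0 ≤ S) (hT : 0 ≤ T)
    (hxy : √3 * max R S ≤ ‖x - y‖) (hxz : √3 * max R T ≤ ‖x - z‖)
    (hyz : √3 * max S T ≤ ‖y - z‖) :
    Disjoint (radicalSector x y R S) (radicalSector x z R T) := by
  refine Set.disjoint_left.2 fun p hpy hpz => ?_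
  exact not_mem_three_discs hxy hxz hyz
    (norm_radialProjection_sub hR.le (ne_of_mem_radicalSector hpy)).le
    (norm_radialProjection_sub_lt (ne_of_mul_max_le hR hxy) hR hS hpy)
    (norm_radialProjection_sub_lt (ne_of_mul_max_le hR hxz) hR hT hpz)

lemma volume_radicalCap_le {x y : Plane} {R S : ℝ} (hR : 0 < R) (hS : 0 ≤ S)
    (h : √3 * max R S ≤ ‖x - y‖) :
    volume (radicalCap x y R S) ≤ ENNReal.ofReal capRatio * volume (radicalSector x y R S) :=
  volume_discCap_le (norm_direction (ne_of_mul_max_le hR h)) hR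
    (le_axisDist hR hS (norm_sub_rev x y ▸ h))

end PowerDiagram

section PowerCells

open Metric

variable {ι : Type*} [DecidableEq ι] {s : Finset ι} {x : ι → Plane} {R : ι → ℝ} {i : ι}

/-- The cell of the power diagram of the circles of radii `R j` about `x j`, `j ∈ s`, intersected
with the disc of its own circle. -/
def powerCell (s : Finset ι) (x : ι → Plane) (R : ι → ℝ) (i : ι) : Set Plane :=
  ball (x i) (R i) ∩ ⋂ j ∈ s.erase i, {p | power (x i) (R i) p < power (x j) (R j) p}

lemma powerCell_subset_ball : powerCell s x R i ⊆ ball (x i) (R i) := Set.inter_subset_left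

lemma measurableSet_powerCell : MeasurableSet (powerCell s x R i) := by
  refine measurableSet_ball.inter (Finset.measurableSet_biInter _ fun j _ => ?_)
  unfold power
  apply measurableSet_lt <;> fun_prop

lemma volume_powerCell_ne_top : volume (powerCell s x R i) ≠ ∞ :=
  measure_ne_top_of_subset powerCell_subset_ball measure_ball_lt_top.ne

lemma pairwiseDisjoint_powerCell : (s : Set ι).PairwiseDisjoint (powerCell s x R) := by
  intro i hi j hj hij
  refine Set.disjoint_left.2 fun p hpi hpj => ?_
  have hlt : power (x i) (R i) p < power (x j) (R j) p :=
    Set.mem_iInter₂.1 hpi.2 j (Finset.mem_erase.2 ⟨hij.symm, hj⟩)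
  exact hlt.not_gt (Set.mem_iInter₂.1 hpj.2 i (Finset.mem_erase.2 ⟨hij, hi⟩))

lemma ball_subset_powerCell_union_radicalCap (hne : ∀ j ∈ s.erase i, x i ≠ x j) :
    ball (x i) (R i) ⊆
      powerCell s x R i ∪ ⋃ j ∈ s.erase i, radicalCap (x i) (x j) (R i) (R j) := by
  intro p hp
  by_cases h : p ∈ ⋂ j ∈ s.erase i, {p | power (x i) (R i) p < power (x j) (R j) p}
  · exact Or.inl ⟨hp, h⟩
  · simp only [Set.mem_iInter, not_forall] at h
    obtain ⟨j, hj, hlt⟩ := h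
    exact Or.inr (Set.mem_iUnion₂.2
      ⟨j, hj, hp, (power_le_power_iff (hne j hj)).1 (not_lt.1 hlt)⟩)

lemma measurableSet_radicalSector (x y : Plane) (R S : ℝ) :
    MeasurableSet (radicalSector x y R S) :=
  measurableSet_ball.inter (measurableSet_lt (by fun_prop) (by fun_prop))

lemma volume_iUnion_radicalCap_le (hR : ∀ i ∈ s, 0 < R i)
    (hsep : (s : Set ι).Pairwise fun i j => √3 * max (R i) (R j) ≤ ‖x i - x j‖) (hi : i ∈ s) :
    volume (⋃ j ∈ s.erase i, radicalCap (x i) (x j) (R i) (R j)) ≤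
      ENNReal.ofReal capRatio * volume (ball (x i) (R i)) := by
  have hmem {j : ι} (hj : j ∈ s.erase i) : j ∈ s := Finset.mem_of_mem_erase hj
  have hsep' {j : ι} (hj : j ∈ s.erase i) : √3 * max (R i) (R j) ≤ ‖x i - x j‖ :=
    hsep hi (hmem hj) (Finset.ne_of_mem_erase hj).symm
  have hdisj : (s.erase i : Set ι).PairwiseDisjoint
      fun j => radicalSector (x i) (x j) (R i) (R j) := fun j hj k hk hjk =>
    disjoint_radicalSector (hR i hi) (hR j (hmem hj)).le (hR k (hmem hk)).le (hsep' hj) (hsep' hk)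
      (hsep (hmem hj) (hmem hk) hjk)
  calc volume (⋃ j ∈ s.erase i, radicalCap (x i) (x j) (R i) (R j))
      ≤ ∑ j ∈ s.erase i, volume (radicalCap (x i) (x j) (R i) (R j)) :=
        measure_biUnion_finset_le _ _
    _ ≤ ∑ j ∈ s.erase i,
          ENNReal.ofReal capRatio * volume (radicalSector (x i) (x j) (R i) (R j)) :=
        Finset.sum_le_sum fun j hj =>
          volume_radicalCap_le (hR i hi) (hR j (hmem hj)).le (hsep' hj)
    _ = ENNReal.ofReal capRatio *
          volume (⋃ j ∈ s.erase i, radicalSector (x i) (x j) (R i) (R j)) := by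
        rw [← Finset.mul_sum, measure_biUnion_finset hdisj
          fun j _ => measurableSet_radicalSector _ _ _ _]
    _ ≤ ENNReal.ofReal capRatio * volume (ball (x i) (R i)) := by
        gcongr
        exact Set.iUnion₂_subset fun j _ => Set.inter_subset_left

/-- The bound is the area of the regular hexagon inscribed in the disc. -/
lemma le_volume_powerCell (hR : ∀ i ∈ s, 0 < R i)
    (hsep : (s : Set ι).Pairwise fun i j => √3 * max (R i) (R j) ≤ ‖x i - x j‖) (hi : i ∈ s) :
    3 * √3 / 2 * R i ^ 2 ≤ volume.real (powerCell s x R i) := by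
  have hne : ∀ j ∈ s.erase i, x i ≠ x j := fun j hj =>
    ne_of_mul_max_le (hR i hi)
      (hsep hi (Finset.mem_of_mem_erase hj) (Finset.ne_of_mem_erase hj).symm)
  have hball : volume.real (ball (x i) (R i)) = R i ^ 2 * Real.pi := by
    rw [Measure.real, EuclideanSpace.volume_ball_fin_two, ← ENNReal.ofReal_pow (hR i hi).le,
      ENNReal.toReal_mul, ENNReal.toReal_ofReal (sq_nonneg _),
      ENNReal.toReal_ofReal Real.pi_nonneg]
  have hcaps : volume.real (⋃ j ∈ s.erase i, radicalCap (x i) (x j) (R i) (R j)) ≤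
      capRatio * volume.real (ball (x i) (R i)) := by
    have h := ENNReal.toReal_mono (ENNReal.mul_ne_top ENNReal.ofReal_ne_top measure_ball_lt_top.ne)
      (volume_iUnion_radicalCap_le hR hsep hi)
    rwa [ENNReal.toReal_mul, ENNReal.toReal_ofReal capRatio_nonneg] at h
  have hfin : volume (⋃ j ∈ s.erase i, radicalCap (x i) (x j) (R i) (R j)) ≠ ∞ :=
    measure_ne_top_of_subset (Set.iUnion₂_subset fun j _ => Set.inter_subset_left)
      (measure_ball_lt_top (x := x i) (r := R i)).ne
  have hcover : volume.real (ball (x i) (R i)) ≤ volume.real (powerCell s x R i) +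
      volume.real (⋃ j ∈ s.erase i, radicalCap (x i) (x j) (R i) (R j)) :=
    (measureReal_mono (ball_subset_powerCell_union_radicalCap hne)
      (measure_union_ne_top volume_powerCell_ne_top hfin)).trans (measureReal_union_le _ _)
  rw [hball] at hcaps hcover
  calc 3 * √3 / 2 * R i ^ 2 = R i ^ 2 * Real.pi - capRatio * (R i ^ 2 * Real.pi) := by
        have := Real.pi_ne_zero
        rw [capRatio]
        field_simp
        ring
    _ ≤ volume.real (powerCell s x R i) := by linarith

end PowerCells

section Duality

open InformationTheory Real

variable {α : Type*} [MeasurableSpace α] {μ ν : Measure α}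

/-- The functional `φ ↦ ∫ φ dμ - ∫ (exp φ - 1) dν`, whose supremum over the bounded functions `φ` is
the Kullback-Leibler divergence of `μ` from `ν`. -/
noncomputable def klDual (μ ν : Measure α) (φ : α → ℝ) : ℝ :=
  ∫ x, φ x ∂μ - ∫ x, (exp (φ x) - 1) ∂ν

lemma integrable_of_abs_le [IsFiniteMeasure ν] {φ : α → ℝ} {M : ℝ} (hφ : Measurable φ)
    (hM : ∀ x, |φ x| ≤ M) : Integrable φ ν :=
  Integrable.of_bound hφ.aestronglyMeasurable M (ae_of_all _ hM)

lemma integrable_exp_of_abs_le [IsFiniteMeasure ν] {φ : α → ℝ} {M : ℝ} (hφ : Measurable φ)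
    (hM : ∀ x, |φ x| ≤ M) : Integrable (fun x => exp (φ x)) ν :=
  integrable_of_abs_le (M := exp M) (by fun_prop) fun x => by
    rw [abs_exp]
    exact exp_le_exp.2 (le_of_abs_le (hM x))

lemma exists_lt_klDual_of_not_ac [IsFiniteMeasure μ] (h : ¬ μ ≪ ν) (a : ℝ) :
    ∃ φ : α → ℝ, Measurable φ ∧ (∃ M, ∀ x, |φ x| ≤ M) ∧ a < klDual μ ν φ := by
  obtain ⟨A, hA, hνA, hμA⟩ : ∃ A, MeasurableSet A ∧ ν A = 0 ∧ μ A ≠ 0 := by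
    by_contra! hcon
    exact h (Measure.AbsolutelyContinuous.mk hcon)
  have hpos : 0 < μ.real A := ENNReal.toReal_pos hμA (measure_ne_top _ _)
  refine ⟨A.indicator fun _ => (a + 1) / μ.real A, measurable_const.indicator hA,
    ⟨_, fun x => norm_indicator_le_norm_self (fun _ => (a + 1) / μ.real A) x⟩, ?_⟩
  have hzero : ∫ x, (exp (A.indicator (fun _ => (a + 1) / μ.real A) x) - 1) ∂ν = 0 := by
    refine integral_eq_zero_of_ae ?_
    filter_upwards [measure_eq_zero_iff_ae_notMem.1 hνA] with x hx
    simp [hx]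
  rw [klDual, hzero, integral_indicator_const _ hA, smul_eq_mul, mul_div_cancel₀ _ hpos.ne']
  linarith

/-- The number `t` truncated to the interval `[(n + 1)⁻¹, n + 1]`. -/
noncomputable def truncate (n : ℕ) (t : ℝ) : ℝ := max (1 / (n + 1)) (min (n + 1) t)

lemma one_div_le_truncate (n : ℕ) (t : ℝ) : 1 / ((n : ℝ) + 1) ≤ truncate n t := le_max_left _ _

lemma truncate_pos (n : ℕ) (t : ℝ) : 0 < truncate n t :=
  Nat.one_div_pos_of_nat.trans_le (one_div_le_truncate n t)

lemma one_div_add_one_le_add_one (n : ℕ) : 1 / ((n : ℝ) + 1) ≤ n + 1 :=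
  (div_le_one₀ (by positivity)).2 (by linarith [n.cast_nonneg (α := ℝ)]) |>.trans
    (by linarith [n.cast_nonneg (α := ℝ)])

lemma abs_log_truncate_le (n : ℕ) (t : ℝ) : |log (truncate n t)| ≤ log (n + 1) := by
  refine abs_le.2 ⟨?_, log_le_log (truncate_pos n t) ?_⟩
  · rw [← log_inv, ← one_div]
    exact log_le_log Nat.one_div_pos_of_nat (one_div_le_truncate n t)
  · exact max_le (one_div_add_one_le_add_one n) (min_le_left _ _)

lemma tendsto_truncate {t : ℝ} (ht : 0 ≤ t) :
    Tendsto (fun n => truncate n t) atTop (𝓝 t) := by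
  have hlim : Tendsto (fun n : ℕ => max (1 / ((n : ℝ) + 1)) t) atTop (𝓝 (max 0 t)) :=
    tendsto_one_div_add_atTop_nhds_zero_nat.max tendsto_const_nhds
  rw [max_eq_right ht] at hlim
  refine hlim.congr' ?_
  filter_upwards [tendsto_natCast_atTop_atTop.eventually_ge_atTop t] with n hn
  rw [truncate, min_eq_right (by linarith)]

lemma tendsto_mul_log_truncate {t : ℝ} (ht : 0 ≤ t) :
    Tendsto (fun n => t * log (truncate n t) - truncate n t + 1) atTop (𝓝 (klFun t)) := by
  have hlog : Tendsto (fun n => t * log (truncate n t)) atTop (𝓝 (t * log t)) := by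
    rcases ht.eq_or_lt with rfl | ht'
    · simp
    · exact ((tendsto_truncate ht).log ht'.ne').const_mul t
  rw [klFun_apply, add_sub_right_comm]
  exact (hlog.sub (tendsto_truncate ht)).add_const 1

lemma one_le_truncate {t : ℝ} (ht : 1 ≤ t) (n : ℕ) : 1 ≤ truncate n t :=
  le_max_of_le_right (le_min (by linarith [n.cast_nonneg (α := ℝ)]) ht)

lemma truncate_le_one {t : ℝ} (ht : t ≤ 1) (n : ℕ) : truncate n t ≤ 1 :=
  max_le ((div_le_one₀ (by positivity)).2 (by linarith [n.cast_nonneg (α := ℝ)]))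
    (min_le_of_right_le ht)

/-- Truncation moves `t` towards `1`. -/
lemma truncate_mul_log_le (n : ℕ) (t : ℝ) :
    truncate n t * log (truncate n t) ≤ t * log (truncate n t) := by
  have hn : 1 / ((n : ℝ) + 1) ≤ 1 :=
    (div_le_one₀ (by positivity)).2 (by linarith [n.cast_nonneg (α := ℝ)])
  rcases le_total 1 t with ht | ht
  · exact mul_le_mul_of_nonneg_right (max_le (hn.trans ht) (min_le_right _ _))
      (log_nonneg (one_le_truncate ht n))
  · refine mul_le_mul_of_nonpos_right (le_max_of_le_right (le_min ?_ le_rfl))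
      (log_nonpos (truncate_pos n t).le (truncate_le_one ht n))
    linarith [n.cast_nonneg (α := ℝ)]

lemma mul_log_truncate_nonneg (n : ℕ) (t : ℝ) :
    0 ≤ t * log (truncate n t) - truncate n t + 1 := by
  have hkl := klFun_nonneg (truncate_pos n t).le
  rw [klFun_apply] at hkl
  linarith [truncate_mul_log_le n t]

lemma measurable_truncate (n : ℕ) : Measurable (truncate n) := by
  unfold truncate
  fun_prop

lemma klDual_log_truncate_rnDeriv [IsFiniteMeasure μ] [IsFiniteMeasure ν] (h : μ ≪ ν) (n : ℕ) :
    ENNReal.ofReal (klDual μ ν fun x => log (truncate n (μ.rnDeriv ν x).toReal)) =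
      ∫⁻ x, ENNReal.ofReal ((μ.rnDeriv ν x).toReal * log (truncate n (μ.rnDeriv ν x).toReal)
        - truncate n (μ.rnDeriv ν x).toReal + 1) ∂ν := by
  set ρ : α → ℝ := fun x => (μ.rnDeriv ν x).toReal with hρ
  set φ : α → ℝ := fun x => log (truncate n (ρ x)) with hφ
  have hφm : Measurable φ :=
    ((measurable_truncate n).comp (Measure.measurable_rnDeriv μ ν).ennreal_toReal).log
  have hφM : ∀ x, |φ x| ≤ log (n + 1) := fun x => abs_log_truncate_le n (ρ x)
  have hρφ : Integrable (fun x => ρ x * φ x) ν :=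
    (integrable_rnDeriv_smul_iff h).2 (integrable_of_abs_le hφm hφM)
  have hexp : Integrable (fun x => exp (φ x) - 1) ν :=
    (integrable_exp_of_abs_le hφm hφM).sub (integrable_const 1)
  have hpt (x : α) : ρ x * φ x - (exp (φ x) - 1) = ρ x * φ x - truncate n (ρ x) + 1 := by
    rw [hφ, exp_log (truncate_pos n (ρ x))]
    ring
  have hdiff : Integrable (fun x => ρ x * φ x - (exp (φ x) - 1)) ν := hρφ.sub hexp
  have hint : klDual μ ν φ = ∫ x, (ρ x * φ x - (exp (φ x) - 1)) ∂ν := by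
    rw [integral_sub hρφ hexp, klDual, ← integral_rnDeriv_smul h]
    simp only [smul_eq_mul, hρ]
  rw [hint, ofReal_integral_eq_lintegral_ofReal hdiff]
  · exact lintegral_congr fun x => congrArg ENNReal.ofReal (hpt x)
  · exact ae_of_all _ fun x => (mul_log_truncate_nonneg n (ρ x)).trans_eq (hpt x).symm

lemma klDiv_le_liminf_klDual_log_truncate [IsFiniteMeasure μ] [IsFiniteMeasure ν] (h : μ ≪ ν) :
    klDiv μ ν ≤ liminf (fun n => ENNReal.ofReal
      (klDual μ ν fun x => log (truncate n (μ.rnDeriv ν x).toReal))) atTop := by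
  simp only [klDiv_eq_lintegral_klFun_of_ac h, klDual_log_truncate_rnDeriv h]
  calc ∫⁻ x, ENNReal.ofReal (klFun (μ.rnDeriv ν x).toReal) ∂ν
      = ∫⁻ x, liminf (fun n => ENNReal.ofReal ((μ.rnDeriv ν x).toReal
          * log (truncate n (μ.rnDeriv ν x).toReal)
          - truncate n (μ.rnDeriv ν x).toReal + 1)) atTop ∂ν :=
        lintegral_congr fun x => ((ENNReal.continuous_ofReal.tendsto _).comp
          (tendsto_mul_log_truncate ENNReal.toReal_nonneg)).liminf_eq.symm
    _ ≤ _ := lintegral_liminf_le fun n => by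
        have := measurable_truncate n
        fun_prop

lemma exists_lt_klDual [IsFiniteMeasure μ] [IsFiniteMeasure ν] {a : ℝ}
    (ha : (a : EReal) < klDiv μ ν) :
    ∃ φ : α → ℝ, Measurable φ ∧ (∃ M, ∀ x, |φ x| ≤ M) ∧ a < klDual μ ν φ := by
  by_cases h : μ ≪ ν
  swap
  · exact exists_lt_klDual_of_not_ac h a
  rcases lt_or_ge a 0 with ha0 | ha0
  · exact ⟨0, measurable_zero, ⟨0, by simp⟩, by simpa [klDual] using ha0⟩
  have ha' : ENNReal.ofReal a < klDiv μ ν := by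
    rwa [← EReal.coe_ennreal_lt_coe_ennreal_iff, EReal.coe_ennreal_ofReal, max_eq_left ha0]
  obtain ⟨n, hn⟩ := (eventually_lt_of_lt_liminf
    (ha'.trans_le (klDiv_le_liminf_klDual_log_truncate h))).exists
  refine ⟨fun x => log (truncate n (μ.rnDeriv ν x).toReal), ?_,
    ⟨log (n + 1), fun x => abs_log_truncate_le n _⟩,
    (ENNReal.ofReal_lt_ofReal_iff_of_nonneg ha0).1 hn⟩
  exact ((measurable_truncate n).comp (Measure.measurable_rnDeriv μ ν).ennreal_toReal).log

lemma exp_sub_exp_le {x y M : ℝ} (hy : y ≤ M) : exp y - exp x ≤ exp M * |x - y| := by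
  have htangent : exp y * (x - y + 1) ≤ exp x := by
    calc exp y * (x - y + 1) ≤ exp y * exp (x - y) :=
          mul_le_mul_of_nonneg_left (add_one_le_exp _) (exp_pos y).le
      _ = exp x := by rw [← exp_add, add_sub_cancel]
  calc exp y - exp x ≤ exp y * (y - x) := by linarith
    _ ≤ exp M * |x - y| := by
        rw [abs_sub_comm]
        exact (mul_le_mul_of_nonneg_left (le_abs_self _) (exp_pos y).le).trans
          (mul_le_mul_of_nonneg_right (exp_le_exp.2 hy) (abs_nonneg _))

lemma klDual_le_klDual_add [IsFiniteMeasure μ] [IsFiniteMeasure ν] {φ ψ : α → ℝ} {M : ℝ}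
    (hφ : Measurable φ) (hφM : ∀ x, |φ x| ≤ M) (hψ : Measurable ψ) (hψM : ∀ x, |ψ x| ≤ M) :
    klDual μ ν φ ≤ klDual μ ν ψ + ∫ x, |φ x - ψ x| ∂μ + exp M * ∫ x, |φ x - ψ x| ∂ν := by
  have hdiff (η : Measure α) [IsFiniteMeasure η] : Integrable (fun x => |φ x - ψ x|) η :=
    ((integrable_of_abs_le hφ hφM).sub (integrable_of_abs_le hψ hψM)).abs
  have hμ : ∫ x, φ x ∂μ - ∫ x, ψ x ∂μ ≤ ∫ x, |φ x - ψ x| ∂μ := by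
    rw [← integral_sub (integrable_of_abs_le hφ hφM) (integrable_of_abs_le hψ hψM)]
    exact integral_mono ((integrable_of_abs_le hφ hφM).sub (integrable_of_abs_le hψ hψM))
      (hdiff μ) fun x => le_abs_self _
  have hν : ∫ x, (exp (ψ x) - 1) ∂ν - ∫ x, (exp (φ x) - 1) ∂ν ≤
      exp M * ∫ x, |φ x - ψ x| ∂ν := by
    have hexp {η : α → ℝ} (hη : Measurable η) (hηM : ∀ x, |η x| ≤ M) :
        Integrable (fun x => exp (η x) - 1) ν :=
      (integrable_exp_of_abs_le hη hηM).sub (integrable_const 1)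
    rw [← integral_sub (hexp hψ hψM) (hexp hφ hφM), ← integral_const_mul]
    refine integral_mono ((hexp hψ hψM).sub (hexp hφ hφM)) ((hdiff ν).const_mul _) fun x => ?_
    simpa using exp_sub_exp_le (x := φ x) (le_of_abs_le (hψM x))
  rw [klDual, klDual]
  linarith

lemma abs_sub_clamp_le {s M : ℝ} (hs : |s| ≤ M) (t : ℝ) :
    |s - max (-M) (min M t)| ≤ |s - t| := by
  obtain ⟨hs₁, hs₂⟩ := abs_le.1 hs
  simpa [Real.dist_eq, min_eq_right hs₂, max_eq_right hs₁] using
    ((LipschitzWith.id.const_min M).const_max (-M)).dist_le_mul s t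

lemma exists_continuous_lt_klDual_of_measurable [TopologicalSpace α] [NormalSpace α] [BorelSpace α]
    [IsFiniteMeasure μ] [IsFiniteMeasure ν] [(μ + ν).WeaklyRegular] {φ : α → ℝ} (hφ : Measurable φ)
    {M : ℝ} (hM0 : 0 ≤ M) (hM : ∀ x, |φ x| ≤ M) {a : ℝ} (ha : a < klDual μ ν φ) :
    ∃ ψ : α → ℝ, Continuous ψ ∧ (∀ x, |ψ x| ≤ M) ∧ a < klDual μ ν ψ := by
  obtain ⟨δ, hδ, hδa⟩ : ∃ δ > 0, exp M * δ < klDual μ ν φ - a :=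
    ⟨(klDual μ ν φ - a) / (2 * exp M), div_pos (sub_pos.2 ha) (by positivity), by
      field_simp
      linarith⟩
  obtain ⟨g, hg, -⟩ :=
    (integrable_of_abs_le (ν := μ + ν) hφ hM).exists_boundedContinuous_integral_sub_le hδ
  set ψ : α → ℝ := fun x => max (-M) (min M (g x))
  have hψc : Continuous ψ := by fun_prop
  have hψM : ∀ x, |ψ x| ≤ M := fun x =>
    abs_le.2 ⟨le_max_left _ _, max_le (by linarith) (min_le_left _ _)⟩
  have hdiff (η : Measure α) [IsFiniteMeasure η] : Integrable (fun x => |φ x - ψ x|) η :=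
    ((integrable_of_abs_le hφ hM).sub (integrable_of_abs_le hψc.measurable hψM)).abs
  have hL1 : ∫ x, |φ x - ψ x| ∂μ + ∫ x, |φ x - ψ x| ∂ν ≤ δ := by
    rw [← integral_add_measure (hdiff μ) (hdiff ν)]
    exact (integral_mono (hdiff _) ((integrable_of_abs_le hφ hM).sub (g.integrable _)).norm
      fun x => abs_sub_clamp_le (hM x) (g x)).trans hg
  have hL1μ : ∫ x, |φ x - ψ x| ∂μ ≤ exp M * ∫ x, |φ x - ψ x| ∂μ :=
    le_mul_of_one_le_left (integral_nonneg fun x => abs_nonneg _) (one_le_exp hM0)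
  refine ⟨ψ, hψc, hψM, ?_⟩
  have hkl := klDual_le_klDual_add (μ := μ) (ν := ν) hφ hM hψc.measurable hψM
  have := mul_le_mul_of_nonneg_left hL1 (exp_pos M).le
  linarith

theorem exists_continuous_lt_klDual [TopologicalSpace α] [NormalSpace α] [BorelSpace α]
    [IsFiniteMeasure μ] [IsFiniteMeasure ν] [(μ + ν).WeaklyRegular] {a : ℝ}
    (ha : (a : EReal) < klDiv μ ν) :
    ∃ ψ : α → ℝ, Continuous ψ ∧ (∃ M, ∀ x, |ψ x| ≤ M) ∧ a < klDual μ ν ψ := by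
  obtain ⟨φ, hφ, ⟨M, hM⟩, haφ⟩ := exists_lt_klDual ha
  obtain ⟨ψ, hψ, hψM, haψ⟩ := exists_continuous_lt_klDual_of_measurable hφ (abs_nonneg M)
    (fun x => (hM x).trans (le_abs_self M)) haφ
  exact ⟨ψ, hψ, ⟨|M|, hψM⟩, haψ⟩

end Duality

section Entropy

open InformationTheory Real

variable {Ω : Set Plane}

lemma neg_mul_log_le_one {t : ℝ} (ht : 0 ≤ t) : -(t * log t) ≤ 1 := by
  linarith [klFun_nonneg ht, klFun_apply t]

lemma ofReal_klFun_add {t : ℝ} (ht : 0 ≤ t) :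
    ENNReal.ofReal (klFun t) + ENNReal.ofReal t + ENNReal.ofReal (-(t * log t)) =
      ENNReal.ofReal (t * log t) + 1 := by
  rw [← ENNReal.ofReal_add (klFun_nonneg ht) ht, klFun_apply, sub_add_cancel]
  rcases le_total 0 (t * log t) with h | h
  · rw [ENNReal.ofReal_add h zero_le_one, ENNReal.ofReal_one,
      ENNReal.ofReal_of_nonpos (neg_nonpos.2 h), add_zero]
  · rw [← ENNReal.ofReal_add (by linarith [neg_mul_log_le_one ht]) (neg_nonneg.2 h),
      ENNReal.ofReal_of_nonpos h, add_right_comm, add_neg_cancel, zero_add,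
      ENNReal.ofReal_one, zero_add]

lemma klDiv_add_lintegral_eq {α : Type*} [MeasurableSpace α] {μ ν : Measure α}
    [IsFiniteMeasure μ] [IsFiniteMeasure ν] (h : μ ≪ ν) {ρ : α → ℝ}
    (hρ : ρ = fun x => (μ.rnDeriv ν x).toReal) :
    klDiv μ ν + μ Set.univ + ∫⁻ x, ENNReal.ofReal (-(ρ x * log (ρ x))) ∂ν =
      ∫⁻ x, ENNReal.ofReal (ρ x * log (ρ x)) ∂ν + ν Set.univ := by
  have hρm : Measurable ρ := hρ ▸ (Measure.measurable_rnDeriv μ ν).ennreal_toReal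
  have hmass : μ Set.univ = ∫⁻ x, ENNReal.ofReal (ρ x) ∂ν := by
    rw [← Measure.lintegral_rnDeriv h]
    refine lintegral_congr_ae ?_
    filter_upwards [Measure.rnDeriv_lt_top μ ν] with x hx
    rw [hρ, ENNReal.ofReal_toReal hx.ne]
  have hkl : klDiv μ ν = ∫⁻ x, ENNReal.ofReal (klFun (ρ x)) ∂ν := by
    rw [klDiv_eq_lintegral_klFun_of_ac h, hρ]
  rw [hkl, hmass, ← lintegral_add_right _ (by fun_prop), ← lintegral_add_right _ (by fun_prop),
    ← lintegral_one, ← lintegral_add_right _ measurable_const]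
  exact lintegral_congr fun x => ofReal_klFun_add (by rw [hρ]; exact ENNReal.toReal_nonneg)

lemma coe_sub_coe_eq_of_add_eq {k p q v : ℝ≥0∞} (hq : q ≠ ∞) (hv : v ≠ ∞)
    (h : k + 1 + q = p + v) : (p : EReal) - q = k + ((1 - v.toReal : ℝ) : EReal) := by
  lift q to NNReal using hq
  lift v to NNReal using hv
  have hkp : k = ∞ ↔ p = ∞ := by
    have htop : k + 1 + q = ∞ ↔ p + v = ∞ := by rw [h]
    simpa [ENNReal.add_eq_top] using htop
  by_cases hp : p = ∞
  · rw [hkp.2 hp, hp]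
    rfl
  lift k to NNReal using mt hkp.1 hp
  lift p to NNReal using hp
  have hreal : (k : ℝ) + 1 + q = p + v := by exact_mod_cast h
  simp only [ENNReal.coe_toReal, EReal.coe_nnreal_eq_coe_real]
  exact_mod_cast (by linarith : (p : ℝ) - q = k + (1 - v))

theorem entropy_eq_klDiv_add [IsFiniteMeasure (area Ω)] (μ : ProbabilityMeasure Ω) :
    entropy μ = (klDiv (μ : Measure Ω) (area Ω) : EReal) +
      ((1 - (area Ω).real Set.univ : ℝ) : EReal) := by
  by_cases hac : (μ : Measure Ω) ≪ area Ω
  swap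
  · rw [entropy, if_neg hac, klDiv_of_not_ac hac, EReal.coe_ennreal_top, EReal.top_add_coe]
  have hsum := klDiv_add_lintegral_eq hac rfl
  rw [measure_univ] at hsum
  simp only [entropy, if_pos hac]
  refine coe_sub_coe_eq_of_add_eq ?_ (measure_ne_top _ _) hsum
  refine ne_top_of_le_ne_top (measure_ne_top (area Ω) Set.univ) ?_
  rw [← lintegral_one]
  refine lintegral_mono fun x => ?_
  simpa using ENNReal.ofReal_le_ofReal (neg_mul_log_le_one ENNReal.toReal_nonneg)

theorem exists_continuous_lt_of_lt_entropy [IsFiniteMeasure (area Ω)] {μ : ProbabilityMeasure Ω}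
    {a : ℝ} (ha : (a : EReal) < entropy μ) :
    ∃ φ : Ω → ℝ, Continuous φ ∧ (∃ M, ∀ x, |φ x| ≤ M) ∧
      a < ∫ x, φ x ∂(μ : Measure Ω) + 1 - ∫ x, exp (φ x) ∂area Ω := by
  have hkl : ((a - (1 - (area Ω).real Set.univ) : ℝ) : EReal) < klDiv (μ : Measure Ω) (area Ω) := by
    rw [entropy_eq_klDiv_add] at ha
    rw [EReal.coe_sub]
    exact EReal.sub_lt_of_lt_add ha
  obtain ⟨φ, hφ, ⟨M, hM⟩, haφ⟩ := exists_continuous_lt_klDual hkl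
  refine ⟨φ, hφ, ⟨M, hM⟩, ?_⟩
  rw [klDual, integral_sub (integrable_exp_of_abs_le hφ.measurable hM) (integrable_const 1)] at haφ
  simp only [integral_const, smul_eq_mul, mul_one] at haφ
  linarith

end Entropy

section Area

variable {Ω : Set Plane}

lemma area_apply (hΩ : IsCompact Ω) (s : Set Ω) : area Ω s = volume (Subtype.val '' s) :=
  comap_subtype_coe_apply hΩ.measurableSet _ _

lemma area_preimage_val (hΩ : IsCompact Ω) (s : Set Plane) :
    area Ω (Subtype.val ⁻¹' s) = volume (s ∩ Ω) := by
  rw [area_apply hΩ, Subtype.image_preimage_coe, Set.inter_comm]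

lemma isFiniteMeasure_area (hΩ : IsCompact Ω) : IsFiniteMeasure (area Ω) := by
  refine ⟨?_⟩
  rw [area_apply hΩ, Subtype.coe_image_univ]
  exact hΩ.measure_lt_top

lemma area_real_preimage_val_add (hΩ : IsCompact Ω) {C : Set Plane} (hC : volume C ≠ ∞) :
    (area Ω).real (Subtype.val ⁻¹' C) + volume.real (C \ Ω) = volume.real C := by
  rw [measureReal_def, area_preimage_val hΩ]
  exact measureReal_inter_add_sdiff hΩ.measurableSet hC

lemma tendsto_volume_cthickening_sdiff (hΩ : IsCompact Ω) :
    Tendsto (fun δ => volume.real (Metric.cthickening δ Ω \ Ω)) (𝓝[>] 0) (𝓝 0) := by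
  have hthick : Tendsto (fun δ => volume.real (Metric.cthickening δ Ω)) (𝓝[>] 0)
      (𝓝 (volume.real Ω)) :=
    ((ENNReal.tendsto_toReal hΩ.measure_lt_top.ne).comp
      (tendsto_measure_cthickening_of_isCompact hΩ)).mono_left nhdsWithin_le_nhds
  have hdiff := hthick.sub_const (volume.real Ω)
  rw [sub_self] at hdiff
  refine hdiff.congr fun δ => ?_
  rw [measureReal_sdiff (Metric.self_subset_cthickening _) hΩ.measurableSet
    hΩ.cthickening.measure_lt_top.ne]

end Area

section CellEstimate

open Real

variable {Ω : Set Plane}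

lemma mul_exp_le_setIntegral_add (hΩ : IsCompact Ω) {C : Set Plane} (hC : MeasurableSet C)
    (hCtop : volume C ≠ ∞) {v : ℝ} (hv : v ≤ volume.real C) {φ : Ω → ℝ}
    (hφ : Integrable (fun y => exp (φ y)) (area Ω)) {x : Ω} {ω M : ℝ} (hM : φ x ≤ M)
    (hω : ∀ y : Ω, (y : Plane) ∈ C → φ x ≤ φ y + ω) :
    v * exp (φ x) ≤ exp ω * ∫ y in Subtype.val ⁻¹' C, exp (φ y) ∂area Ω +
      exp M * volume.real (C \ Ω) := by
  have := isFiniteMeasure_area hΩ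
  have hinside : (area Ω).real (Subtype.val ⁻¹' C) * exp (φ x) ≤
      exp ω * ∫ y in Subtype.val ⁻¹' C, exp (φ y) ∂area Ω := by
    rw [← smul_eq_mul, ← setIntegral_const, ← integral_const_mul]
    refine setIntegral_mono_on (integrable_const _).integrableOn (hφ.const_mul _).integrableOn
      (measurable_subtype_coe hC) fun y hy => ?_
    rw [← exp_add, exp_le_exp, add_comm]
    exact hω y hy
  calc v * exp (φ x) ≤ volume.real C * exp (φ x) := by gcongr
    _ = (area Ω).real (Subtype.val ⁻¹' C) * exp (φ x) + exp (φ x) * volume.real (C \ Ω) := by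
        rw [← area_real_preimage_val_add hΩ hCtop]
        ring
    _ ≤ _ := add_le_add hinside (by gcongr)

lemma mul_sq_le_volume_powerCell {ι : Type*} [DecidableEq ι] {s : Finset ι} {x : ι → Plane}
    {r : ι → ℝ} (hr : ∀ i ∈ s, 0 < r i)
    (hsep : (s : Set ι).Pairwise fun i j => 2 * max (r i) (r j) ≤ ‖x i - x j‖) {i : ι}
    (hi : i ∈ s) : 2 * √3 * r i ^ 2 ≤ volume.real (powerCell s x (fun i => 2 / √3 * r i) i) := by
  calc 2 * √3 * r i ^ 2 = 3 * √3 / 2 * (2 / √3 * r i) ^ 2 := by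
        rw [mul_pow, div_pow, sq_sqrt (by norm_num)]
        ring
    _ ≤ _ := le_volume_powerCell (s := s) (x := x) (R := fun i => 2 / √3 * r i)
        (fun j hj => mul_pos (by positivity) (hr j hj)) (fun j hj k hk hjk => ?_) hi
  dsimp only
  rw [← mul_max_of_nonneg _ _ (by positivity), ← mul_assoc, mul_div_cancel₀ _ (by positivity)]
  exact hsep hj hk hjk

lemma sum_area_mul_exp_le (hΩ : IsCompact Ω) {s : Finset Ω} {r : Ω → ℝ} {η ω M : ℝ}
    (hr : ∀ x ∈ s, 0 < r x) (hrη : ∀ x ∈ s, r x ≤ η)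
    (hsep : (s : Set Ω).Pairwise fun x y => 2 * max (r x) (r y) ≤ dist x y)
    {φ : Ω → ℝ} (hφ : Integrable (fun x => exp (φ x)) (area Ω)) (hM : ∀ x, φ x ≤ M)
    (hω : ∀ x y, dist x y < 2 / √3 * η → φ x ≤ φ y + ω) :
    ∑ x ∈ s, 2 * √3 * r x ^ 2 * exp (φ x) ≤ exp ω * ∫ x, exp (φ x) ∂area Ω +
      exp M * volume.real (Metric.cthickening (2 / √3 * η) Ω \ Ω) := by
  classical
  set C : Ω → Set Plane := powerCell s Subtype.val fun x => 2 / √3 * r x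
  have hC_ball (x : Ω) (hx : x ∈ s) : C x ⊆ Metric.ball (x : Plane) (2 / √3 * η) :=
    powerCell_subset_ball.trans (Metric.ball_subset_ball (by gcongr; exact hrη x hx))
  have hC_meas (x : Ω) : MeasurableSet (C x) := measurableSet_powerCell
  have hC_disj : (s : Set Ω).PairwiseDisjoint C := pairwiseDisjoint_powerCell
  have hC_top (x : Ω) : volume (C x) ≠ ∞ := volume_powerCell_ne_top
  have hC_vol (x : Ω) (hx : x ∈ s) : 2 * √3 * r x ^ 2 ≤ volume.real (C x) :=
    mul_sq_le_volume_powerCell hr (fun y hy z hz hyz => (hsep hy hz hyz).trans_eq (by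
      rw [Subtype.dist_eq, dist_eq_norm])) hx
  have hcell (x : Ω) (hx : x ∈ s) := mul_exp_le_setIntegral_add hΩ (hC_meas x) (hC_top x)
    (hC_vol x hx) hφ (hM x) fun y hy => hω x y (by
      rw [dist_comm]
      exact hC_ball x hx hy)
  refine (Finset.sum_le_sum hcell).trans ?_
  rw [Finset.sum_add_distrib, ← Finset.mul_sum, ← Finset.mul_sum]
  gcongr
  · rw [← integral_biUnion_finset s (fun x _ => measurable_subtype_coe (hC_meas x))
      (fun x hx y hy hxy => (hC_disj hx hy hxy).preimage _) fun x _ => hφ.integrableOn]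
    exact setIntegral_le_integral hφ (ae_of_all _ fun x => (exp_pos _).le)
  · rw [← measureReal_biUnion_finset
      (fun x hx y hy hxy => (hC_disj hx hy hxy).mono Set.sdiff_subset Set.sdiff_subset)
      (fun x _ => (hC_meas x).diff hΩ.measurableSet)
      (fun x _ => measure_ne_top_of_subset Set.sdiff_subset (hC_top x))]
    refine measureReal_mono (Set.iUnion₂_subset fun x hx p hp => ⟨?_, hp.2⟩)
      (measure_ne_top_of_subset Set.sdiff_subset hΩ.cthickening.measure_lt_top.ne)
    exact Metric.mem_cthickening_of_dist_le p x _ _ x.2 (hC_ball x hx hp.1).le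

end CellEstimate

section DiscreteEntropy

open Real

variable {Ω : Set Plane} (X : Configuration Ω)

lemma numPoints_pos : 0 < numPoints X := Finset.card_pos.2 X.2

lemma two_mul_halfMinDist_le {x y : Ω} (hy : y ∈ X.1) (hxy : x ≠ y) :
    2 * halfMinDist X x ≤ dist x y := by
  have hinf := Metric.infDist_le_dist_of_mem (x := x)
    (show y ∈ (X.1 : Set Ω) \ {x} from ⟨hy, hxy.symm⟩)
  rw [halfMinDist]
  linarith

lemma pairwise_two_mul_max_halfMinDist_le :
    (X.1 : Set Ω).Pairwise fun x y => 2 * max (halfMinDist X x) (halfMinDist X y) ≤ dist x y := by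
  intro x hx y hy hxy
  rw [mul_max_of_nonneg _ _ zero_le_two]
  exact max_le (two_mul_halfMinDist_le X hy hxy)
    (dist_comm x y ▸ two_mul_halfMinDist_le X hx hxy.symm)

variable {X}

lemma nonempty_sdiff_of_two_le (hX : 2 ≤ numPoints X) (x : Ω) : ((X.1 : Set Ω) \ {x}).Nonempty := by
  obtain ⟨y, hy, hyx⟩ := Finset.exists_mem_ne (s := X.1) hX x
  exact ⟨y, hy, hyx⟩

lemma halfMinDist_pos (hX : 2 ≤ numPoints X) (x : Ω) : 0 < halfMinDist X x := by
  have hclosed : IsClosed ((X.1 : Set Ω) \ {x}) := X.1.finite_toSet.sdiff.isClosed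
  exact mul_pos one_half_pos ((hclosed.notMem_iff_infDist_pos (nonempty_sdiff_of_two_le hX x)).1
    fun h => h.2 rfl)

lemma halfMinDist_le_diam (hΩ : IsCompact Ω) (hX : 2 ≤ numPoints X) (x : Ω) :
    halfMinDist X x ≤ Metric.diam Ω := by
  obtain ⟨y, hy, hyx⟩ := nonempty_sdiff_of_two_le hX x
  have hdiam : dist x y ≤ Metric.diam Ω := Metric.dist_le_diam_of_mem hΩ.isBounded x.2 y.2
  linarith [two_mul_halfMinDist_le X hy (Ne.symm hyx), halfMinDist_pos hX x]

lemma integral_empirical (X : Configuration Ω) (f : Ω → ℝ) :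
    ∫ x, f x ∂(empirical X : Measure Ω) = (numPoints X : ℝ)⁻¹ * ∑ x ∈ X.1, f x := by
  have hdef : (empirical X : Measure Ω) =
    (numPoints X : ℝ≥0∞)⁻¹ • ∑ x ∈ X.1, Measure.dirac x := rfl
  rw [hdef, integral_smul_measure, integral_finsetSum_measure]
  · simp
  · exact fun x _ => integrable_dirac (by simp)

lemma discreteEntropy_eq_sum (X : Configuration Ω) :
    discreteEntropy X = (numPoints X : ℝ)⁻¹ * ∑ x ∈ X.1,
      (-2 * log (halfMinDist X x) - log (2 * √3 * numPoints X)) := by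
  have hN : (numPoints X : ℝ) ≠ 0 := Nat.cast_ne_zero.2 (numPoints_pos X).ne'
  rw [discreteEntropy, Finset.sum_sub_distrib, Finset.sum_const, ← Finset.mul_sum, nsmul_eq_mul,
    ← numPoints]
  field_simp

lemma log_le_log_min_add {r η : ℝ} (hr : 0 < r) (hη : 0 < η) :
    log r ≤ log (min r η) + r ^ 2 / η ^ 2 := by
  rcases le_total r η with h | h
  · rw [min_eq_left h]
    linarith [show 0 ≤ r ^ 2 / η ^ 2 by positivity]
  · rw [min_eq_right h, ← div_pow]
    have hlog := log_le_sub_one_of_pos (show 0 < r / η by positivity)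
    rw [log_div hr.ne' hη.ne'] at hlog
    nlinarith [sq_nonneg (r / η - 1)]

/-- The bound is `log t ≤ t - 1` at `t = 2 √3 N (min r η)² e ^ u`; the last term on the left pays
for the truncation of `r`. -/
lemma le_neg_two_mul_log_sub_log {r η N : ℝ} (hr : 0 < r) (hη : 0 < η) (hN : 0 < N) (u : ℝ) :
    u + 1 - N * (2 * √3 * min r η ^ 2 * exp u) - 2 / η ^ 2 * r ^ 2 ≤
      -2 * log r - log (2 * √3 * N) := by
  have : 0 < min r η := lt_min hr hη
  have hlog := log_le_sub_one_of_pos (show 0 < 2 * √3 * N * min r η ^ 2 * exp u by positivity)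
  rw [log_mul (by positivity) (by positivity), log_exp, log_mul (by positivity) (by positivity),
    log_pow, Nat.cast_ofNat] at hlog
  have htrunc := log_le_log_min_add hr hη
  have heq : 2 / η ^ 2 * r ^ 2 = 2 * (r ^ 2 / η ^ 2) := by ring
  linarith

lemma le_discreteEntropy (hX : 2 ≤ numPoints X) (φ : Ω → ℝ) {η : ℝ} (hη : 0 < η) :
    ∫ x, φ x ∂(empirical X : Measure Ω) + 1
      - ∑ x ∈ X.1, 2 * √3 * min (halfMinDist X x) η ^ 2 * exp (φ x)
      - (numPoints X : ℝ)⁻¹ * (2 / η ^ 2 * ∑ x ∈ X.1, halfMinDist X x ^ 2) ≤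
      discreteEntropy X := by
  have hN : (0 : ℝ) < numPoints X := Nat.cast_pos.2 (numPoints_pos X)
  have hsum := Finset.sum_le_sum fun x (_ : x ∈ X.1) =>
    le_neg_two_mul_log_sub_log (halfMinDist_pos hX x) hη hN (φ x)
  rw [discreteEntropy_eq_sum, integral_empirical]
  refine le_trans (le_of_eq ?_) (mul_le_mul_of_nonneg_left hsum (inv_nonneg.2 hN.le))
  rw [Finset.sum_sub_distrib, Finset.sum_sub_distrib, Finset.sum_add_distrib, Finset.sum_const,
    ← Finset.mul_sum, nsmul_eq_mul, ← numPoints, ← Finset.mul_sum]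
  field_simp

lemma exists_sum_sq_halfMinDist_le (hΩ : IsCompact Ω) :
    ∃ K : ℝ, ∀ X : Configuration Ω, 2 ≤ numPoints X → ∑ x ∈ X.1, halfMinDist X x ^ 2 ≤ K := by
  have := isFiniteMeasure_area hΩ
  refine ⟨(∫ _ : Ω, 1 ∂area Ω + volume.real (Metric.cthickening (2 / √3 * Metric.diam Ω) Ω \ Ω)) /
    (2 * √3), fun X hX => ?_⟩
  have hB := sum_area_mul_exp_le hΩ (fun x _ => halfMinDist_pos hX x)
    (fun x _ => halfMinDist_le_diam hΩ hX x) (pairwise_two_mul_max_halfMinDist_le X)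
    (φ := fun _ => 0) (ω := 0) (M := 0) (integrable_const _) (fun _ => le_rfl) (by simp)
  rw [le_div_iff₀' (by positivity), Finset.mul_sum]
  simpa only [exp_zero, mul_one, one_mul] using hB

end DiscreteEntropy

section GammaLiminf

open Real

variable {Ω : Set Plane}

lemma exists_pos_exp_mul_lt {I ε : ℝ} (hε : 0 < ε) : ∃ ω > 0, exp ω * I < I + ε := by
  have hlim : Tendsto (fun ω => exp ω * I) (𝓝[>] 0) (𝓝 I) := by
    simpa using ((continuous_exp.tendsto 0).mul_const I).mono_left nhdsWithin_le_nhds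
  obtain ⟨ω, hlt, hω⟩ :=
    ((hlim.eventually_lt_const (lt_add_of_pos_right I hε)).and self_mem_nhdsWithin).exists
  exact ⟨ω, hω, hlt⟩

lemma exists_pos_volume_cthickening_sdiff_lt (hΩ : IsCompact Ω) {δ ε C : ℝ} (hδ : 0 < δ)
    (hε : 0 < ε) :
    ∃ η > 0, 2 / √3 * η < δ ∧ C * volume.real (Metric.cthickening (2 / √3 * η) Ω \ Ω) < ε := by
  have hlim : Tendsto (fun t => C * volume.real (Metric.cthickening t Ω \ Ω)) (𝓝[>] 0) (𝓝 0) := by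
    simpa using (tendsto_volume_cthickening_sdiff hΩ).const_mul C
  obtain ⟨t, hvol, htδ, ht : 0 < t⟩ := ((hlim.eventually_lt_const hε).and
    (((eventually_lt_nhds hδ).filter_mono nhdsWithin_le_nhds).and self_mem_nhdsWithin)).exists
  have heq : 2 / √3 * (√3 / 2 * t) = t := by field_simp
  exact ⟨√3 / 2 * t, by positivity, by rwa [heq], by rwa [heq]⟩

lemma exists_sum_area_mul_exp_lt (hΩ : IsCompact Ω) {φ : Ω → ℝ} (hφ : Continuous φ) {M : ℝ}
    (hM : ∀ x, |φ x| ≤ M) {ε : ℝ} (hε : 0 < ε) :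
    ∃ η > 0, ∀ X : Configuration Ω, 2 ≤ numPoints X →
      ∑ x ∈ X.1, 2 * √3 * min (halfMinDist X x) η ^ 2 * exp (φ x) <
        ∫ x, exp (φ x) ∂area Ω + ε := by
  have := isFiniteMeasure_area hΩ
  have : CompactSpace Ω := isCompact_iff_compactSpace.1 hΩ
  obtain ⟨ω, hω, hωI⟩ := exists_pos_exp_mul_lt (I := ∫ x, exp (φ x) ∂area Ω) (half_pos hε)
  obtain ⟨δ, hδ, hδω⟩ := Metric.uniformContinuous_iff.1
    (CompactSpace.uniformContinuous_of_continuous hφ) ω hω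
  obtain ⟨η, hη, hηδ, hηv⟩ :=
    exists_pos_volume_cthickening_sdiff_lt hΩ (C := exp M) hδ (half_pos hε)
  refine ⟨η, hη, fun X hX => ?_⟩
  have hsum := sum_area_mul_exp_le hΩ (s := X.1) (r := fun x => min (halfMinDist X x) η) (ω := ω)
    (fun x _ => lt_min (halfMinDist_pos hX x) hη) (fun x _ => min_le_right _ _)
    (fun x hx y hy hxy => ?_) (integrable_exp_of_abs_le hφ.measurable hM)
    (fun x => le_of_abs_le (hM x)) fun x y hxy => ?_
  · linarith
  · refine le_trans ?_ (pairwise_two_mul_max_halfMinDist_le X hx hy hxy)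
    gcongr <;> exact min_le_left _ _
  · have hclose := hδω (hxy.trans hηδ)
    rw [Real.dist_eq] at hclose
    linarith [(abs_lt.1 hclose).2]

theorem eventually_lt_discreteEntropy (hΩ : IsCompact Ω) {ι : Type*} {l : Filter ι}
    {X : ι → Configuration Ω} {μ : ProbabilityMeasure Ω}
    (hX : Tendsto (fun i => numPoints (X i)) l atTop)
    (hμ : Tendsto (fun i => empirical (X i)) l (𝓝 μ)) {a : ℝ} (ha : (a : EReal) < entropy μ) :
    ∀ᶠ i in l, a < discreteEntropy (X i) := by
  have := isFiniteMeasure_area hΩ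
  have : CompactSpace Ω := isCompact_iff_compactSpace.1 hΩ
  obtain ⟨φ, hφ, ⟨M, hM⟩, haφ⟩ := exists_continuous_lt_of_lt_entropy ha
  obtain ⟨K, hK⟩ := exists_sum_sq_halfMinDist_le hΩ
  obtain ⟨ε, hε, haε⟩ : ∃ ε > 0, a + 3 * ε <
      ∫ x, φ x ∂(μ : Measure Ω) + 1 - ∫ x, exp (φ x) ∂area Ω :=
    ⟨(∫ x, φ x ∂(μ : Measure Ω) + 1 - ∫ x, exp (φ x) ∂area Ω - a) / 6, by linarith, by linarith⟩
  obtain ⟨η, hη, hηsum⟩ := exists_sum_area_mul_exp_lt hΩ hφ hM hε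
  have hN : Tendsto (fun i => (numPoints (X i) : ℝ)⁻¹ * (2 / η ^ 2 * K)) l (𝓝 0) := by
    have hinv := (tendsto_inv_atTop_nhds_zero_nat (𝕜 := ℝ)).comp hX
    simpa only [zero_mul, Function.comp_apply] using hinv.mul_const (2 / η ^ 2 * K)
  have hint : Tendsto (fun i => ∫ x, φ x ∂(empirical (X i) : Measure Ω)) l
      (𝓝 (∫ x, φ x ∂(μ : Measure Ω))) :=
    ProbabilityMeasure.tendsto_iff_forall_integral_tendsto.1 hμ
      (BoundedContinuousFunction.mkOfCompact ⟨φ, hφ⟩)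
  filter_upwards [hX.eventually_ge_atTop 2, hN.eventually_lt_const hε,
    hint.eventually_const_lt (sub_lt_self _ hε)] with i hi hNi hinti
  have hKi : (numPoints (X i) : ℝ)⁻¹ * (2 / η ^ 2 * ∑ x ∈ (X i).1, halfMinDist (X i) x ^ 2) ≤
      (numPoints (X i) : ℝ)⁻¹ * (2 / η ^ 2 * K) := by
    gcongr
    exact hK _ hi
  linarith [le_discreteEntropy hi φ hη, hηsum (X i) hi]

theorem entropy_le_liminf (hΩ : IsCompact Ω) {X : ℕ+ → Configuration Ω} {μ : ProbabilityMeasure Ω}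
    (hXN : ∀ N : ℕ+, numPoints (X N) = N) (hX : Tendsto (fun N => empirical (X N)) atTop (𝓝 μ)) :
    entropy μ ≤ liminf (fun N => ((discreteEntropy (X N) : ℝ) : EReal)) atTop := by
  have hN : Tendsto (fun N => numPoints (X N)) atTop atTop := by
    simpa only [hXN] using tendsto_PNat_val_atTop_atTop
  refine EReal.ge_of_forall_gt_iff_ge.1 fun a ha => ?_
  refine le_liminf_of_le (by isBoundedDefault) ?_
  filter_upwards [eventually_lt_discreteEntropy hΩ hN hX ha] with N hN
  exact_mod_cast hN.le

end GammaLiminf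

section Lattice

open Module

lemma exists_finset_subset_le_card {ι : Type*} {S : Set ι} {c : ℝ≥0∞} (hc : c ≠ ∞)
    (h : c ≤ S.encard) : ∃ s : Finset ι, ↑s ⊆ S ∧ c ≤ s.card := by
  obtain hS | hS := S.finite_or_infinite
  · refine ⟨hS.toFinset, hS.coe_toFinset.subset, ?_⟩
    rwa [hS.encard_eq_coe_toFinset_card, ENat.toENNReal_coe] at h
  · obtain ⟨n, hn⟩ := ENNReal.exists_nat_gt hc
    obtain ⟨s, hs, rfl⟩ := hS.exists_subset_card_eq n
    exact ⟨s, hs, hn.le⟩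

-- First moment method: averaged over `x ∈ F`, the orbit of `x` meets `B` in `μ B / μ F` points.
theorem exists_finset_measure_le_card_mul {G α : Type*} [AddGroup G] [Countable G] [AddAction G α]
    [MeasurableSpace α] [MeasurableConstVAdd G α] {μ : Measure α} [VAddInvariantMeasure G α μ]
    {F B : Set α} (hF : IsAddFundamentalDomain G F μ) (hF0 : μ F ≠ 0) (hFtop : μ F ≠ ∞)
    (hB : MeasurableSet B) (hBtop : μ B ≠ ∞) :
    ∃ x, ∃ s : Finset G, (∀ g ∈ s, g +ᵥ x ∈ B) ∧ μ B ≤ s.card * μ F := by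
  have hcount : μ B = ∫⁻ x in F, ∑' g : G, B.indicator 1 (g +ᵥ x) ∂μ := by
    have hmeas (g : G) : AEMeasurable (fun x => B.indicator (1 : α → ℝ≥0∞) (g +ᵥ x))
        (μ.restrict F) :=
      ((measurable_one.indicator hB).comp (measurable_const_vadd g)).aemeasurable
    rw [lintegral_tsum hmeas, ← hF.lintegral_eq_tsum'', lintegral_indicator_one hB]
  obtain ⟨x, -, hx⟩ := exists_setLAverage_le hF0 hF.nullMeasurableSet (hcount ▸ hBtop)
  have horbit : ∑' g : G, B.indicator (1 : α → ℝ≥0∞) (g +ᵥ x) =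
      ({g : G | g +ᵥ x ∈ B}.encard : ℝ≥0∞) := by
    rw [← ENNReal.tsum_set_one, tsum_subtype {g : G | g +ᵥ x ∈ B} fun _ => (1 : ℝ≥0∞)]
    rfl
  rw [setLAverage_eq, ← hcount, horbit] at hx
  obtain ⟨s, hs, hcard⟩ := exists_finset_subset_le_card (ENNReal.div_ne_top hBtop hF0) hx
  exact ⟨x, s, fun g hg => hs hg, (ENNReal.div_le_iff hF0 hFtop).1 hcard⟩

lemma one_le_sq_add_mul_add_sq {m n : ℤ} (h : m ≠ 0 ∨ n ≠ 0) : 1 ≤ m ^ 2 + m * n + n ^ 2 := by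
  have hpos : 0 < m ^ 2 + (m + n) ^ 2 + n ^ 2 := by
    obtain h | h := h <;> positivity
  linarith [show 2 * (m ^ 2 + m * n + n ^ 2) = m ^ 2 + (m + n) ^ 2 + n ^ 2 by ring]

/-- The generators of the triangular lattice with minimal distance `d`. -/
noncomputable def triangularVectors (d : ℝ) : Fin 2 → Plane := ![!₂[d, 0], !₂[d / 2, √3 / 2 * d]]

lemma det_triangularVectors (d : ℝ) :
    (EuclideanSpace.basisFun (Fin 2) ℝ).toBasis.det (triangularVectors d) = √3 / 2 * d ^ 2 := by
  rw [Basis.det_apply, Matrix.det_fin_two]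
  simp [Basis.toMatrix_apply, triangularVectors]
  ring

lemma le_norm_of_mem_span_triangularVectors {d : ℝ} {v : Plane}
    (hv : v ∈ Submodule.span ℤ (Set.range (triangularVectors d))) (hv0 : v ≠ 0) : d ≤ ‖v‖ := by
  obtain ⟨c, rfl⟩ := (Submodule.mem_span_range_iff_exists_fun ℤ).1 hv
  have hc : c 0 ≠ 0 ∨ c 1 ≠ 0 := by
    by_contra! h
    simp [h] at hv0
  have hform : (1 : ℝ) ≤ (c 0 : ℝ) ^ 2 + c 0 * c 1 + (c 1 : ℝ) ^ 2 := by
    exact_mod_cast one_le_sq_add_mul_add_sq hc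
  have hnorm : ‖∑ i, c i • triangularVectors d i‖ ^ 2 =
      d ^ 2 * ((c 0 : ℝ) ^ 2 + c 0 * c 1 + (c 1 : ℝ) ^ 2) := by
    rw [EuclideanSpace.real_norm_sq_eq]
    simp [triangularVectors]
    ring_nf
    norm_num
    ring
  refine le_of_sq_le_sq ?_ (norm_nonneg _)
  rw [hnorm]
  exact le_mul_of_one_le_right (sq_nonneg d) hform

lemma volume_fundamentalDomain_eq_abs_det {ι E : Type*} [Fintype ι] [DecidableEq ι]
    [NormedAddCommGroup E] [InnerProductSpace ℝ E] [FiniteDimensional ℝ E] [MeasurableSpace E]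
    [BorelSpace E] (e : OrthonormalBasis ι ℝ E) (b : Basis ι ℝ E) :
    volume (ZSpan.fundamentalDomain b) = ENNReal.ofReal |e.toBasis.det b| := by
  rw [ZSpan.measure_fundamentalDomain b volume e.toBasis,
    measure_congr (ZSpan.fundamentalDomain_ae_parallelepiped e.toBasis volume),
    e.coe_toBasis, e.volume_parallelepiped, mul_one]

theorem exists_separated_finset_volume_le {B : Set Plane} (hB : MeasurableSet B)
    (hBtop : volume B ≠ ∞) {d : ℝ} (hd : 0 < d) :
    ∃ s : Finset Plane, ↑s ⊆ B ∧ volume.real B ≤ s.card * (√3 / 2 * d ^ 2) ∧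
      (s : Set Plane).Pairwise fun x y => d ≤ dist x y := by
  classical
  have harea : 0 < √3 / 2 * d ^ 2 := by positivity
  obtain ⟨hli, hspan⟩ := ((EuclideanSpace.basisFun (Fin 2) ℝ).toBasis.is_basis_iff_det).2
    (det_triangularVectors d ▸ harea.ne'.isUnit)
  set b := Basis.mk hli hspan.ge with hb
  set L := (Submodule.span ℤ (Set.range b)).toAddSubgroup
  have hF : volume (ZSpan.fundamentalDomain b) = ENNReal.ofReal (√3 / 2 * d ^ 2) := by
    rw [volume_fundamentalDomain_eq_abs_det (EuclideanSpace.basisFun (Fin 2) ℝ), hb, Basis.coe_mk,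
      det_triangularVectors, abs_of_pos harea]
  have : Countable L := inferInstanceAs (Countable (Submodule.span ℤ (Set.range b)))
  obtain ⟨x, s, hs, hcard⟩ := exists_finset_measure_le_card_mul
    (ZSpan.isAddFundamentalDomain' b volume) (ZSpan.measure_fundamentalDomain_ne_zero b)
    (hF ▸ ENNReal.ofReal_ne_top) hB hBtop
  have hdist {g h : L} (hgh : g ≠ h) : d ≤ dist (g +ᵥ x) (h +ᵥ x) := by
    rw [AddSubgroup.vadd_def, AddSubgroup.vadd_def, vadd_eq_add, vadd_eq_add, dist_add_right,
      dist_eq_norm]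
    refine le_norm_of_mem_span_triangularVectors ?_
      (sub_ne_zero.2 (Subtype.coe_ne_coe.2 hgh))
    have hmem : (g : Plane) - h ∈ Submodule.span ℤ (Set.range b) := (g - h).2
    rwa [hb, Basis.coe_mk] at hmem
  have hinj : Function.Injective fun g : L => g +ᵥ x :=
    fun g h hgh => of_not_not fun hne => (hd.trans_le (hdist hne)).ne' (dist_eq_zero.2 hgh)
  refine ⟨s.image (· +ᵥ x), ?_, ?_, ?_⟩
  · rw [Finset.coe_image]
    exact Set.image_subset_iff.2 hs
  · rw [Finset.card_image_of_injective _ hinj, ← ENNReal.ofReal_le_ofReal_iff (by positivity),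
      ofReal_measureReal hBtop, ENNReal.ofReal_mul (by positivity), ENNReal.ofReal_natCast, ← hF]
    exact hcard
  · rw [Finset.coe_image]
    rintro _ ⟨g, -, rfl⟩ _ ⟨h, -, rfl⟩ hne
    exact hdist fun hgh => hne (hgh ▸ rfl)

end Lattice

section Partition

open InformationTheory Real

lemma rnDeriv_mul_singleton {ι : Type*} [MeasurableSpace ι] [MeasurableSingletonClass ι]
    {μ ν : Measure ι} [IsFiniteMeasure μ] [IsFiniteMeasure ν] (h : μ ≪ ν) (i : ι) :
    μ.rnDeriv ν i * ν {i} = μ {i} := by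
  rw [← Measure.setLIntegral_rnDeriv h, lintegral_singleton]

lemma toReal_klDiv_eq_sum {ι : Type*} [Fintype ι] [MeasurableSpace ι] [MeasurableSingletonClass ι]
    {μ ν : Measure ι} [IsFiniteMeasure μ] [IsFiniteMeasure ν] (h : μ ≪ ν) :
    (klDiv μ ν).toReal =
      ∑ i, μ.real {i} * log (μ.real {i} / ν.real {i}) + ν.real Set.univ - μ.real Set.univ := by
  have hterm (i : ι) : ν.real {i} * klFun (μ.rnDeriv ν i).toReal =
      μ.real {i} * log (μ.real {i} / ν.real {i}) + ν.real {i} - μ.real {i} := by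
    have hmul : (μ.rnDeriv ν i).toReal * ν.real {i} = μ.real {i} := by
      rw [measureReal_def, ← ENNReal.toReal_mul, rnDeriv_mul_singleton h, measureReal_def]
    rcases eq_or_ne (ν.real {i}) 0 with hν | hν
    · simp [← hmul, hν]
    · rw [← hmul, mul_div_cancel_right₀ _ hν, klFun_apply]
      ring
  have huniv (κ : Measure ι) [IsFiniteMeasure κ] : ∑ i, κ.real {i} = κ.real Set.univ := by
    rw [sum_measureReal_singleton, Finset.coe_univ]
  rw [toReal_klDiv_eq_integral_klFun h, integral_fintype .of_finite]
  simp only [smul_eq_mul, hterm, Finset.sum_sub_distrib, Finset.sum_add_distrib, huniv]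

theorem sum_mul_log_le_entropy {Ω : Set Plane} [IsFiniteMeasure (area Ω)] {ι : Type*} [Fintype ι]
    [MeasurableSpace ι] [MeasurableSingletonClass ι] {p : Ω → ι} (hp : Measurable p)
    (μ : ProbabilityMeasure Ω) :
    ((∑ i, (μ : Measure Ω).real (p ⁻¹' {i}) *
      log ((μ : Measure Ω).real (p ⁻¹' {i}) / (area Ω).real (p ⁻¹' {i})) : ℝ) : EReal) ≤
      entropy μ := by
  by_cases hkl : klDiv (μ : Measure Ω) (area Ω) = ∞
  · rw [entropy_eq_klDiv_add, hkl, EReal.coe_ennreal_top, EReal.top_add_coe]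
    exact le_top
  have hac := (klDiv_ne_top_iff.1 hkl).1
  have hdata := ENNReal.toReal_mono hkl (klDiv_map_le (μ := (μ : Measure Ω)) (ν := area Ω) hp)
  rw [toReal_klDiv_eq_sum (hac.map hp)] at hdata
  simp only [map_measureReal_apply hp (measurableSet_singleton _),
    map_measureReal_apply hp MeasurableSet.univ, Set.preimage_univ, probReal_univ] at hdata
  rw [entropy_eq_klDiv_add, ← EReal.coe_ennreal_toReal hkl, ← EReal.coe_add, EReal.coe_le_coe_iff]
  linarith

lemma exists_measurable_fin_dist_le (α : Type*) [PseudoMetricSpace α] [CompactSpace α]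
    [MeasurableSpace α] [OpensMeasurableSpace α] {ε : ℝ} (hε : 0 < ε) :
    ∃ (n : ℕ) (p : α → Fin n), Measurable p ∧ ∀ x y, p x = p y → dist x y ≤ ε := by
  obtain ⟨t, -, ht, hcover⟩ := finite_cover_balls_of_compact (isCompact_univ (X := α))
    (half_pos hε)
  have := ht.fintype
  classical
  let balls (x : α) (c : t) : Prop := x ∈ Metric.ball (c : α) (ε / 2)
  have hballs : Measurable balls :=
    measurable_pi_lambda _ fun c => measurableSet_setOfPred.1 measurableSet_ball
  refine ⟨_, Fintype.equivFin _ ∘ balls, Measurable.of_discrete.comp hballs, fun x y hxy => ?_⟩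
  obtain ⟨c, hc, hx⟩ := Set.mem_iUnion₂.1 (hcover (Set.mem_univ x))
  have hy : y ∈ Metric.ball c (ε / 2) :=
    (congrFun ((Fintype.equivFin _).injective hxy) ⟨c, hc⟩).mp hx
  linarith [dist_triangle_right x y c, Metric.mem_ball.1 hx, Metric.mem_ball.1 hy]

end Partition

section WeakConvergence

lemma levyProkhorovDist_le_of_forall_fiber_le {α ι : Type*} [PseudoMetricSpace α]
    [MeasurableSpace α] [OpensMeasurableSpace α] [Fintype ι] [MeasurableSpace ι]
    [MeasurableSingletonClass ι] {p : α → ι} (hp : Measurable p) {μ ν : Measure α}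
    [IsProbabilityMeasure μ] [IsProbabilityMeasure ν] {ε η : ℝ}
    (hdiam : ∀ x y, p x = p y → dist x y ≤ ε) (hη : 0 ≤ η)
    (hηε : Fintype.card ι * η ≤ ε)
    (h : ∀ i, ν.real (p ⁻¹' {i}) ≤ μ.real (p ⁻¹' {i}) + η) : levyProkhorovDist ν μ ≤ ε := by
  classical
  have hε : 0 ≤ ε := (by positivity : 0 ≤ Fintype.card ι * η).trans hηε
  refine levyProkhorovDist_le_of_forall_le ν μ hε fun δ B hδ _ => ?_
  let I : Finset ι := {i | (B ∩ p ⁻¹' {i}).Nonempty}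
  have hB : B ⊆ p ⁻¹' I := fun x hx => by simpa [I] using ⟨x, hx, rfl⟩
  have hI : p ⁻¹' I ⊆ Metric.thickening δ B := fun x hx => by
    obtain ⟨y, hy, hyx⟩ : (B ∩ p ⁻¹' {p x}).Nonempty := by simpa [I] using hx
    exact Metric.mem_thickening_iff.2 ⟨y, hy, (hdiam x y hyx.symm).trans_lt hδ⟩
  have hsum (κ : Measure α) [IsProbabilityMeasure κ] :
      ∑ i ∈ I, κ.real (p ⁻¹' {i}) = κ.real (p ⁻¹' I) :=
    sum_measureReal_preimage_singleton I fun i _ => hp (measurableSet_singleton i)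
  have hcard : (I.card : ℝ) * η ≤ δ :=
    (mul_le_mul_of_nonneg_right (Nat.cast_le.2 I.card_le_univ) hη).trans (hηε.trans hδ.le)
  have hreal : ν.real B ≤ μ.real (Metric.thickening δ B) + δ := calc
    ν.real B ≤ ∑ i ∈ I, ν.real (p ⁻¹' {i}) := hsum ν ▸ measureReal_mono hB
    _ ≤ ∑ i ∈ I, (μ.real (p ⁻¹' {i}) + η) := Finset.sum_le_sum fun i _ => h i
    _ = μ.real (p ⁻¹' I) + I.card * η := by
        rw [Finset.sum_add_distrib, hsum μ, Finset.sum_const, nsmul_eq_mul]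
    _ ≤ μ.real (Metric.thickening δ B) + δ := add_le_add (measureReal_mono hI) hcard
  rw [← ofReal_measureReal (μ := ν), ← ofReal_measureReal (μ := μ),
    ← ENNReal.ofReal_add measureReal_nonneg (hε.trans hδ.le)]
  exact ENNReal.ofReal_le_ofReal hreal

lemma exists_pos_forall_levyProkhorovDist_lt_mem {α : Type*} [PseudoMetricSpace α]
    [MeasurableSpace α] [OpensMeasurableSpace α] {μ : ProbabilityMeasure α}
    {U : Set (ProbabilityMeasure α)} (hU : U ∈ 𝓝 μ) :
    ∃ ε > 0, ∀ ν : ProbabilityMeasure α,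
      levyProkhorovDist (ν : Measure α) (μ : Measure α) < ε → ν ∈ U := by
  obtain ⟨ε, hε, hball⟩ := Metric.mem_nhds_iff.1
    (LevyProkhorov.continuous_toMeasure_probabilityMeasure.continuousAt
      (x := LevyProkhorov.ofMeasure μ) hU)
  exact ⟨ε, hε, fun ν hν => hball (a := LevyProkhorov.ofMeasure ν) hν⟩

lemma empirical_real_preimage_singleton {Ω : Set Plane} {ι : Type*} [DecidableEq ι]
    [MeasurableSpace ι] [MeasurableSingletonClass ι] {p : Ω → ι} (hp : Measurable p)
    (X : Configuration Ω) (i : ι) :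
    (empirical X : Measure Ω).real (p ⁻¹' {i}) =
      (numPoints X : ℝ)⁻¹ * (X.1.filter (p · = i)).card := by
  rw [← integral_indicator_one (hp (measurableSet_singleton i)), integral_empirical,
    Finset.card_filter, Nat.cast_sum]
  congr 1
  refine Finset.sum_congr rfl fun x _ => ?_
  by_cases hx : p x = i <;> simp [hx]

theorem exists_forall_tendsto_of_eventually {α β : Type*} {l : Filter β} [l.IsCountablyGenerated]
    {p : ℕ → α → Prop} {F : α → β} (hp : ∀ N, 0 < N → ∃ x, p N x)
    (h : ∀ U ∈ l, ∀ᶠ N in atTop, ∃ x, p N x ∧ F x ∈ U) :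
    ∃ x : ℕ+ → α, (∀ N : ℕ+, p N (x N)) ∧ Tendsto (F ∘ x) atTop l := by
  obtain ⟨U, hU⟩ := l.exists_antitone_basis
  have hbest (N : ℕ+) (k : ℕ) :
      ∃ x, p N x ∧ ∀ m < k, (∃ y, p N y ∧ F y ∈ U m) → F x ∈ U m := by
    induction k with
    | zero => exact (hp N N.pos).imp fun x hx => ⟨hx, fun m hm => absurd hm m.not_lt_zero⟩
    | succ k ih =>
      by_cases hk : ∃ y, p N y ∧ F y ∈ U k
      · obtain ⟨y, hy, hyk⟩ := hk
        exact ⟨y, hy, fun m hm _ => hU.antitone (Nat.lt_succ_iff.1 hm) hyk⟩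
      · obtain ⟨x, hx, hxk⟩ := ih
        refine ⟨x, hx, fun m hm hy => ?_⟩
        rcases Nat.lt_succ_iff_lt_or_eq.1 hm with hm | rfl
        exacts [hxk m hm hy, absurd hy hk]
  choose x hx hxU using fun N : ℕ+ => hbest N N
  refine ⟨x, hx, hU.tendsto_right_iff.2 fun m _ => ?_⟩
  filter_upwards [tendsto_PNat_val_atTop_atTop.eventually (h (U m) (hU.mem m)),
    tendsto_PNat_val_atTop_atTop.eventually_gt_atTop m] with N hN hm
  exact hxU N m hm hN

end WeakConvergence

section Quantization

open Real

variable {Ω : Set Plane} {ι : Type*}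

/-- The side of the triangular lattice whose fundamental cell has area `v / m`, so that a region
of area `v` contains about `m` of its points. -/
noncomputable def spacing (v m : ℝ) : ℝ := √(2 * v / (√3 * m))

lemma spacing_pos {v m : ℝ} (hv : 0 < v) (hm : 0 < m) : 0 < spacing v m :=
  sqrt_pos.2 (by positivity)

lemma spacing_sq {v m : ℝ} (hv : 0 ≤ v) (hm : 0 ≤ m) :
    spacing v m ^ 2 = 2 * v / (√3 * m) :=
  sq_sqrt (by positivity)

lemma tendsto_spacing (v w : ℝ) :
    Tendsto (fun N : ℕ => spacing v (N * w)) atTop (𝓝 0) := by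
  have hlim : Tendsto (fun N : ℕ => √(2 * v / (√3 * w) * (N : ℝ)⁻¹)) atTop (𝓝 √(_ * 0)) :=
    (tendsto_inv_atTop_nhds_zero_nat.const_mul _).sqrt
  rw [mul_zero, sqrt_zero] at hlim
  refine hlim.congr fun N => ?_
  rw [spacing, ← div_eq_mul_inv, div_div, mul_assoc, mul_comm w]

lemma exists_finset_card_eq_ceil (hΩ : IsCompact Ω) {K : Set Ω} (hK : MeasurableSet K) {m : ℝ}
    (hm : 0 < m → 0 < (area Ω).real K) :
    ∃ s : Finset Ω, ↑s ⊆ K ∧ s.card = ⌈m⌉₊ ∧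
      (s : Set Ω).Pairwise fun x y => spacing ((area Ω).real K) m ≤ dist x y := by
  classical
  rcases le_or_gt m 0 with hm0 | hm0
  · exact ⟨∅, by simp [Nat.ceil_eq_zero.2 hm0]⟩
  have hv := hm hm0
  have hsub : Subtype.val '' K ⊆ Ω := Subtype.coe_image_subset Ω K
  obtain ⟨s, hsK, hcard, hsep⟩ := exists_separated_finset_volume_le
    ((MeasurableEmbedding.subtype_coe hΩ.measurableSet).measurableSet_image' hK)
    (measure_ne_top_of_subset hsub hΩ.measure_lt_top.ne) (spacing_pos hv hm0)
  have hceil : ⌈m⌉₊ ≤ (s.subtype (· ∈ Ω)).card := by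
    rw [measureReal_def, ← area_apply hΩ, ← measureReal_def, spacing_sq hv.le hm0.le] at hcard
    rw [Finset.card_subtype, Finset.filter_true_of_mem fun x hx => hsub (hsK hx), Nat.ceil_le]
    have hcell : (s.card : ℝ) * (√3 / 2 * (2 * (area Ω).real K / (√3 * m))) =
        (area Ω).real K * s.card / m := by field_simp
    rw [hcell, le_div_iff₀ hm0] at hcard
    exact le_of_mul_le_mul_left hcard hv
  obtain ⟨t, hts, htcard⟩ := Finset.exists_subset_card_eq hceil
  have hval {x : Ω} (hx : x ∈ t) : (x : Plane) ∈ s := Finset.mem_subtype.1 (hts hx)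
  refine ⟨t, fun x hx => ?_, htcard, fun x hx y hy hxy =>
    hsep (hval hx) (hval hy) (Subtype.coe_injective.ne hxy)⟩
  exact (Subtype.val_injective.mem_set_image).1 (hsK (hval hx))

lemma le_halfMinDist {X : Configuration Ω} (hX : 2 ≤ numPoints X) {x : Ω} {d : ℝ}
    (hd : ∀ y ∈ X.1, y ≠ x → d ≤ dist x y) : d / 2 ≤ halfMinDist X x := by
  have hinf : d ≤ Metric.infDist x ((X.1 : Set Ω) \ {x}) :=
    (Metric.le_infDist (nonempty_sdiff_of_two_le hX x)).2 fun {y} hy => hd y hy.1 hy.2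
  rw [halfMinDist]
  linarith

lemma neg_two_mul_log_sub_log_le {v w N r : ℝ} (hv : 0 < v) (hw : 0 < w) (hN : 0 < N)
    (hr : spacing v (N * w) / 2 ≤ r) :
    -2 * log r - log (2 * √3 * N) ≤ log (w / v) := by
  have hd := spacing_pos hv (mul_pos hN hw)
  have hlog := log_le_log (by positivity) (pow_le_pow_left₀ (by positivity) hr 2)
  have hsq : (spacing v (N * w) / 2) ^ 2 = (w / v)⁻¹ / (2 * √3 * N) := by
    rw [div_pow, spacing_sq hv.le (by positivity)]
    field_simp
  rw [hsq, log_div (by positivity) (by positivity), log_inv, log_pow, Nat.cast_ofNat] at hlog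
  linarith

lemma exists_pos_forall_le_dist {α : Type*} [PseudoMetricSpace α] [Finite ι] {K : ι → Set α}
    (hK : ∀ i, IsCompact (K i)) (hclosed : ∀ i, IsClosed (K i))
    (hdisj : Pairwise (Function.onFun Disjoint K)) :
    ∃ δ > 0, ∀ i j, i ≠ j → ∀ x ∈ K i, ∀ y ∈ K j, δ ≤ dist x y := by
  have hev : ∀ᶠ δ : ℝ in 𝓝[>] 0, ∀ i j, i ≠ j → ∀ x ∈ K i, ∀ y ∈ K j, δ ≤ dist x y := by
    refine eventually_all.2 fun i => eventually_all.2 fun j => ?_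
    by_cases hij : i = j
    · exact Eventually.of_forall fun _ h => absurd hij h
    obtain ⟨r, hr, hlt⟩ := Metric.exists_pos_forall_lt_edist (hK i) (hclosed j) (hdisj hij)
    filter_upwards [Ioo_mem_nhdsGT (NNReal.coe_pos.2 hr)] with δ hδ _ x hx y hy
    have hdist := hlt x hx y hy
    rw [edist_nndist, ENNReal.coe_lt_coe, ← NNReal.coe_lt_coe, coe_nndist] at hdist
    exact (hδ.2.trans hdist).le
  obtain ⟨δ, hδ, hδ0⟩ := (hev.and self_mem_nhdsWithin).exists
  exact ⟨δ, hδ0, hδ⟩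

lemma sum_mul_le_of_le_add_one [Fintype ι] {c u l : ι → ℝ} {C : ℝ} (hc : ∀ i, c i ≤ u i + 1)
    (hsum : ∑ i, c i = ∑ i, u i) (hl : ∀ i, -C ≤ l i) :
    ∑ i, c i * l i ≤ ∑ i, u i * l i + ∑ i, (l i + C) := by
  have hterm : ∑ i, (c i - u i) * (l i + C) ≤ ∑ i, (l i + C) :=
    Finset.sum_le_sum fun i _ => by nlinarith [hc i, hl i]
  have hexpand : ∑ i, (c i - u i) * (l i + C) =
      ∑ i, c i * l i - ∑ i, u i * l i + (∑ i, c i - ∑ i, u i) * C := by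
    simp only [sub_mul, mul_add, Finset.sum_add_distrib, Finset.sum_sub_distrib, ← Finset.sum_mul]
  rw [hexpand, hsum] at hterm
  linarith

variable [Fintype ι] [DecidableEq ι] {p : Ω → ι} {K : ι → Set Ω}

lemma exists_configuration_spacing_le (hΩ : IsCompact Ω) (hK : ∀ i, MeasurableSet (K i))
    (hKp : ∀ i, ∀ x ∈ K i, p x = i) {u : ι → ℝ} (hu : ∀ i, 0 ≤ u i)
    (hv : ∀ i, 0 < u i → 0 < (area Ω).real (K i)) {N : ℕ} (hN : 0 < N) (hsum : ∑ i, u i = N)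
    (hsep : ∀ i j, i ≠ j → ∀ x ∈ K i, ∀ y ∈ K j,
      spacing ((area Ω).real (K i)) (u i) ≤ dist x y) :
    ∃ X : Configuration Ω, numPoints X = N ∧
      (∀ i, ((X.1.filter (p · = i)).card : ℝ) ≤ u i + 1) ∧ ∀ x ∈ X.1, 0 < u (p x) ∧
        ∀ y ∈ X.1, y ≠ x → spacing ((area Ω).real (K (p x))) (u (p x)) ≤ dist x y := by
  classical
  choose S hSK hScard hSsep using fun i => exists_finset_card_eq_ceil hΩ (hK i) (hv i)
  have hSp {i : ι} {x : Ω} (hx : x ∈ S i) : p x = i := hKp i x (hSK i hx)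
  have hcard : N ≤ (Finset.univ.biUnion S).card := by
    rw [Finset.card_biUnion fun i _ j _ hij => Finset.disjoint_left.2 fun x hi hj =>
      hij ((hSp hi).symm.trans (hSp hj))]
    have hle : ∑ i, u i ≤ ∑ i, ((S i).card : ℝ) :=
      Finset.sum_le_sum fun i _ => hScard i ▸ Nat.le_ceil _
    rw [hsum] at hle
    exact_mod_cast hle
  obtain ⟨X, hXS, hXN⟩ := Finset.exists_subset_card_eq hcard
  have hmem {x : Ω} (hx : x ∈ X) : x ∈ S (p x) := by
    obtain ⟨i, -, hxi⟩ := Finset.mem_biUnion.1 (hXS hx)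
    rwa [hSp hxi]
  refine ⟨⟨X, Finset.card_pos.1 (hXN ▸ hN)⟩, hXN, fun i => ?_, fun x hx => ⟨?_, fun y hy hyx => ?_⟩⟩
  · have hsub : X.filter (p · = i) ⊆ S i := fun x hx => by
      obtain ⟨hxX, rfl⟩ := Finset.mem_filter.1 hx
      exact hmem hxX
    calc ((X.filter (p · = i)).card : ℝ) ≤ (S i).card := Nat.cast_le.2 (Finset.card_le_card hsub)
      _ ≤ u i + 1 := hScard i ▸ (Nat.ceil_lt_add_one (hu i)).le
  · rw [← Nat.ceil_pos, ← hScard]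
    exact Finset.card_pos.2 ⟨x, hmem hx⟩
  · by_cases hxy : p x = p y
    · exact hSsep _ (hmem hx) (hxy ▸ hmem hy) hyx.symm
    · exact hsep _ _ hxy x (hSK _ (hmem hx)) y (hSK _ (hmem hy))

lemma discreteEntropy_le_sum {X : Configuration Ω} {l : ι → ℝ}
    (h : ∀ x ∈ X.1, -2 * log (halfMinDist X x) - log (2 * √3 * numPoints X) ≤ l (p x)) :
    discreteEntropy X ≤
      (numPoints X : ℝ)⁻¹ * ∑ i, ((X.1.filter (p · = i)).card : ℝ) * l i := by
  have hfiber : ∑ i, ((X.1.filter (p · = i)).card : ℝ) * l i = ∑ x ∈ X.1, l (p x) := by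
    rw [← Finset.sum_fiberwise_of_maps_to' (fun x _ => Finset.mem_univ (p x)) l]
    simp only [Finset.sum_const, nsmul_eq_mul]
  rw [discreteEntropy_eq_sum, hfiber]
  exact mul_le_mul_of_nonneg_left (Finset.sum_le_sum h) (by positivity)

lemma discreteEntropy_le_of_card_fiber_le {X : Configuration Ω} {l w : ι → ℝ} {C : ℝ}
    (h : ∀ x ∈ X.1, -2 * log (halfMinDist X x) - log (2 * √3 * numPoints X) ≤ l (p x))
    (hw : ∑ i, w i = 1) (hl : ∀ i, -C ≤ l i)
    (hcard : ∀ i, ((X.1.filter (p · = i)).card : ℝ) ≤ numPoints X * w i + 1) :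
    discreteEntropy X ≤ ∑ i, w i * l i + (numPoints X : ℝ)⁻¹ * ∑ i, (l i + C) := by
  have hN : (0 : ℝ) < numPoints X := Nat.cast_pos.2 (numPoints_pos X)
  have hcount : ∑ i, ((X.1.filter (p · = i)).card : ℝ) = ∑ i, numPoints X * w i := by
    rw [← Finset.mul_sum, hw, mul_one, ← Nat.cast_sum,
      ← Finset.card_eq_sum_card_fiberwise fun x _ => Finset.mem_univ (p x), numPoints]
  refine (discreteEntropy_le_sum h).trans ?_
  rw [inv_mul_le_iff₀ hN, mul_add, mul_inv_cancel_left₀ hN.ne', Finset.mul_sum]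
  simpa only [mul_assoc] using sum_mul_le_of_le_add_one hcard hcount hl

theorem eventually_exists_discreteEntropy_lt (hΩ : IsCompact Ω) (hK : ∀ i, IsCompact (K i))
    (hKp : ∀ i, ∀ x ∈ K i, p x = i) {w : ι → ℝ} (hw : ∀ i, 0 ≤ w i) (hw1 : ∑ i, w i = 1)
    (hv : ∀ i, 0 < w i → 0 < (area Ω).real (K i)) {a : ℝ}
    (ha : ∑ i, w i * log (w i / (area Ω).real (K i)) < a) :
    ∀ᶠ N : ℕ in atTop, ∃ X : Configuration Ω, numPoints X = N ∧
      (∀ i, ((X.1.filter (p · = i)).card : ℝ) ≤ N * w i + 1) ∧ discreteEntropy X < a := by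
  let l (i : ι) : ℝ := log (w i / (area Ω).real (K i))
  obtain ⟨C, hC⟩ : ∃ C, ∀ i, -C ≤ l i := by
    obtain ⟨b, hb⟩ := Set.finite_range l |>.bddBelow
    exact ⟨-b, fun i => (neg_neg b).symm ▸ hb ⟨i, rfl⟩⟩
  have hdisj : Pairwise (Function.onFun Disjoint K) := fun i j hij =>
    Set.disjoint_left.2 fun x hi hj => hij ((hKp i x hi).symm.trans (hKp j x hj))
  obtain ⟨δ, hδ, hsep⟩ := exists_pos_forall_le_dist hK (fun i => (hK i).isClosed) hdisj
  have herror : Tendsto (fun N : ℕ => ∑ i, w i * l i + (N : ℝ)⁻¹ * ∑ i, (l i + C)) atTop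
      (𝓝 (∑ i, w i * l i)) := by
    simpa using (tendsto_inv_atTop_nhds_zero_nat.mul_const _).const_add (∑ i, w i * l i)
  filter_upwards [eventually_ge_atTop 2, herror.eventually_lt_const ha,
    eventually_all.2 fun i => (tendsto_spacing ((area Ω).real (K i)) (w i)).eventually_le_const hδ]
    with N hN hNa hNδ
  have hN0 : (0 : ℝ) < N := by positivity
  obtain ⟨X, rfl, hXcard, hXsep⟩ := exists_configuration_spacing_le (N := N) hΩ
    (fun i => (hK i).measurableSet) hKp (fun i => mul_nonneg hN0.le (hw i))
    (fun i hi => hv i (pos_of_mul_pos_right hi hN0.le)) (by omega)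
    (by rw [← Finset.mul_sum, hw1, mul_one])
    fun i j hij x hx y hy => (hNδ i).trans (hsep i j hij x hx y hy)
  refine ⟨X, rfl, hXcard, lt_of_le_of_lt ?_ hNa⟩
  refine discreteEntropy_le_of_card_fiber_le (fun x hx => ?_) hw1 hC hXcard
  have hwx : 0 < w (p x) := pos_of_mul_pos_right (hXsep x hx).1 hN0.le
  exact neg_two_mul_log_sub_log_le (hv _ hwx) hwx hN0 (le_halfMinDist hN (hXsep x hx).2)

end Quantization

section GammaRecovery

open Real

variable {Ω : Set Plane}

lemma exists_isCompact_subset_mul_measureReal_le {α : Type*} [TopologicalSpace α]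
    [MeasurableSpace α] {ν : Measure α} [IsFiniteMeasure ν] [ν.InnerRegularCompactLTTop]
    {A : Set α} (hA : MeasurableSet A) {c : ℝ} (hc0 : 0 ≤ c) (hc : c < 1) :
    ∃ K ⊆ A, IsCompact K ∧ c * ν.real A ≤ ν.real K := by
  rcases (measureReal_nonneg (μ := ν) (s := A)).eq_or_lt with h0 | hpos
  · exact ⟨∅, Set.empty_subset A, isCompact_empty, by simp [← h0]⟩
  have hlt : ENNReal.ofReal (c * ν.real A) < ν A :=
    (ENNReal.ofReal_lt_iff_lt_toReal (by positivity) (measure_ne_top _ _)).2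
      (mul_lt_of_lt_one_left hpos hc)
  obtain ⟨K, hKA, hK, hKlt⟩ := hA.exists_lt_isCompact_of_ne_top (measure_ne_top _ _) hlt
  exact ⟨K, hKA, hK, ((ENNReal.ofReal_lt_iff_lt_toReal (by positivity)
    (measure_ne_top _ _)).1 hKlt).le⟩

lemma absolutelyContinuous_of_entropy_lt_top {μ : ProbabilityMeasure Ω} (h : entropy μ < ⊤) :
    (μ : Measure Ω) ≪ area Ω := by
  by_contra hac
  simp [entropy, hac] at h

lemma sum_mul_log_div_le_add {ι : Type*} [Fintype ι] {w v k : ι → ℝ} {ε : ℝ} (hw : ∀ i, 0 ≤ w i)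
    (hw1 : ∑ i, w i = 1) (hv : ∀ i, 0 < w i → 0 < v i) (hk : ∀ i, exp (-ε) * v i ≤ k i) :
    ∑ i, w i * log (w i / k i) ≤ ∑ i, w i * log (w i / v i) + ε := by
  calc ∑ i, w i * log (w i / k i) ≤ ∑ i, (w i * log (w i / v i) + w i * ε) := by
        refine Finset.sum_le_sum fun i _ => ?_
        rcases (hw i).eq_or_lt with h0 | hpos
        · simp [← h0]
        have hvi := hv i hpos
        have hlog := log_le_log (by positivity) (hk i)
        have hki : 0 < k i := (by positivity : 0 < exp (-ε) * v i).trans_le (hk i)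
        rw [log_mul (exp_pos _).ne' hvi.ne', log_exp] at hlog
        rw [← mul_add, log_div hpos.ne' hki.ne', log_div hpos.ne' hvi.ne']
        exact mul_le_mul_of_nonneg_left (by linarith) hpos.le
    _ = ∑ i, w i * log (w i / v i) + ε := by
        rw [Finset.sum_add_distrib, ← Finset.sum_mul, hw1, one_mul]

lemma eventually_exists_card_fiber_le_of_entropy_lt (hΩ : IsCompact Ω)
    {μ : ProbabilityMeasure Ω} {ι : Type*} [Finite ι] [DecidableEq ι] [MeasurableSpace ι]
    [MeasurableSingletonClass ι] {p : Ω → ι} (hp : Measurable p) {a : ℝ}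
    (ha : entropy μ < a) :
    ∀ᶠ N : ℕ in atTop, ∃ X : Configuration Ω, numPoints X = N ∧
      (∀ i, ((X.1.filter (p · = i)).card : ℝ) ≤ N * (μ : Measure Ω).real (p ⁻¹' {i}) + 1) ∧
      discreteEntropy X < a := by
  have : CompactSpace Ω := isCompact_iff_compactSpace.1 hΩ
  have := Fintype.ofFinite ι
  have := isFiniteMeasure_area hΩ
  let w (i : ι) : ℝ := (μ : Measure Ω).real (p ⁻¹' {i})
  let v (i : ι) : ℝ := (area Ω).real (p ⁻¹' {i})
  have hw (i : ι) : 0 ≤ w i := measureReal_nonneg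
  have hw1 : ∑ i, w i = 1 := by
    rw [sum_measureReal_preimage_singleton _ fun i _ => hp (measurableSet_singleton i)]
    simp
  have hv (i : ι) (hi : 0 < w i) : 0 < v i := by
    refine measureReal_nonneg.lt_of_ne' fun h0 => hi.ne' ?_
    have hac := absolutelyContinuous_of_entropy_lt_top (ha.trans (EReal.coe_lt_top a))
    exact (measureReal_eq_zero_iff).2 (hac ((measureReal_eq_zero_iff).1 h0))
  have hwa : ∑ i, w i * log (w i / v i) < a :=
    EReal.coe_lt_coe_iff.1 ((sum_mul_log_le_entropy hp μ).trans_lt ha)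
  obtain ⟨ε, hε, hεa⟩ : ∃ ε > 0, ∑ i, w i * log (w i / v i) + ε < a :=
    ⟨(a - ∑ i, w i * log (w i / v i)) / 2, by linarith, by linarith⟩
  choose K hKp hK hKv using fun i : ι =>
    exists_isCompact_subset_mul_measureReal_le (ν := area Ω) (hp (measurableSet_singleton i))
      (exp_pos (-ε)).le (exp_lt_one_iff.2 (neg_lt_zero.2 hε))
  exact eventually_exists_discreteEntropy_lt hΩ hK hKp hw hw1
    (fun i hi => (mul_pos (exp_pos _) (hv i hi)).trans_le (hKv i))
    ((sum_mul_log_div_le_add hw hw1 hv hKv).trans_lt hεa)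

lemma eventually_exists_configuration (hΩ : IsCompact Ω) {μ : ProbabilityMeasure Ω}
    {U : Set (ProbabilityMeasure Ω)} (hU : U ∈ 𝓝 μ) {a : ℝ} (ha : entropy μ < a) :
    ∀ᶠ N : ℕ in atTop, ∃ X : Configuration Ω, numPoints X = N ∧ empirical X ∈ U ∧
      discreteEntropy X < a := by
  have : CompactSpace Ω := isCompact_iff_compactSpace.1 hΩ
  obtain ⟨ε, hε, hεU⟩ := exists_pos_forall_levyProkhorovDist_lt_mem hU
  obtain ⟨n, p, hp, hdiam⟩ := exists_measurable_fin_dist_le Ω (half_pos hε)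
  have hrounding : Tendsto (fun N : ℕ => (n : ℝ) * (N : ℝ)⁻¹) atTop (𝓝 0) := by
    simpa using tendsto_inv_atTop_nhds_zero_nat.const_mul (n : ℝ)
  filter_upwards [eventually_gt_atTop 0, hrounding.eventually_le_const (half_pos hε),
    eventually_exists_card_fiber_le_of_entropy_lt hΩ hp ha] with N hN hNε ⟨X, hXN, hcard, hXa⟩
  refine ⟨X, hXN, hεU _ ?_, hXa⟩
  refine (levyProkhorovDist_le_of_forall_fiber_le hp hdiam (η := (N : ℝ)⁻¹) (by positivity)
    (by simpa using hNε) fun i => ?_).trans_lt (half_lt_self hε)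
  rw [empirical_real_preimage_singleton hp, hXN, inv_mul_le_iff₀ (by positivity), mul_add,
    mul_inv_cancel₀ (by positivity)]
  exact hcard i

lemma exists_numPoints_eq_of_entropy_lt_top (hΩ : IsCompact Ω) {μ : ProbabilityMeasure Ω}
    (h : entropy μ < ⊤) {N : ℕ} (hN : 0 < N) : ∃ X : Configuration Ω, numPoints X = N := by
  obtain ⟨a, ha, -⟩ := EReal.lt_iff_exists_real_btwn.1 h
  obtain ⟨m, hNm, Y, rfl, -⟩ :=
    ((eventually_ge_atTop N).and (eventually_exists_configuration hΩ univ_mem ha)).exists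
  obtain ⟨X, -, hX⟩ := Finset.exists_subset_card_eq hNm
  exact ⟨⟨X, Finset.card_pos.1 (hX ▸ hN)⟩, hX⟩

theorem exists_recovery_sequence (hΩ : IsCompact Ω) {μ : ProbabilityMeasure Ω}
    (h : entropy μ < ⊤) :
    ∃ X : ℕ+ → Configuration Ω, (∀ N : ℕ+, numPoints (X N) = N) ∧
      Tendsto (fun N => empirical (X N)) atTop (𝓝 μ) ∧
      Tendsto (fun N => ((discreteEntropy (X N) : ℝ) : EReal)) atTop (𝓝 (entropy μ)) := by
  have : CompactSpace Ω := isCompact_iff_compactSpace.1 hΩ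
  obtain ⟨X, hXN, hX⟩ := exists_forall_tendsto_of_eventually
    (p := fun N (X : Configuration Ω) => numPoints X = N) (l := 𝓝 μ ×ˢ 𝓝 (entropy μ))
    (F := fun X => (empirical X, max (discreteEntropy X : EReal) (entropy μ)))
    (fun N hN => exists_numPoints_eq_of_entropy_lt_top hΩ h hN) fun W hW => by
      obtain ⟨U, hU, V, hV, hUV⟩ := mem_prod_iff.1 hW
      obtain ⟨b, hb, hbV⟩ := exists_Ico_subset_of_mem_nhds hV ⟨⊤, h⟩
      obtain ⟨a, ha, hab⟩ := EReal.lt_iff_exists_real_btwn.1 hb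
      filter_upwards [eventually_exists_configuration hΩ hU ha] with N ⟨X, hXN, hXU, hXa⟩
      exact ⟨X, hXN, hUV ⟨hXU, hbV ⟨le_max_right _ _,
        max_lt ((EReal.coe_lt_coe_iff.2 hXa).trans hab) hb⟩⟩⟩
  obtain ⟨hweak, hmax⟩ := tendsto_prod_iff'.1 hX
  have hN : Tendsto (fun N => numPoints (X N)) atTop atTop := by
    simpa only [hXN] using tendsto_PNat_val_atTop_atTop
  refine ⟨X, hXN, hweak, tendsto_order.2 ⟨fun b hb => ?_, fun b hb => ?_⟩⟩
  · obtain ⟨a, hba, ha⟩ := EReal.lt_iff_exists_real_btwn.1 hb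
    filter_upwards [eventually_lt_discreteEntropy hΩ hN hweak ha] with N hNa
    exact hba.trans (EReal.coe_lt_coe_iff.2 hNa)
  · filter_upwards [hmax.eventually_lt_const hb] with N hNb
    exact (le_max_left _ _).trans_lt hNb

end GammaRecovery

end EntropyApprox

theorem theorem2 (Ω : Set EntropyApprox.Plane) (hΩ : IsCompact Ω) :
    EntropyApprox.IsGammaApproximation
      (fun X : EntropyApprox.Configuration Ω =>
        ((EntropyApprox.discreteEntropy X : ℝ) : EReal)) where
  ne_bot _ := EReal.coe_ne_bot _
  liminf_ge _ _ := EntropyApprox.entropy_le_liminf hΩ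
  exists_recovery _ := EntropyApprox.exists_recovery_sequence hΩ
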